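/- Let $q\in\mathbb C$ with $0<|q|<1$. Write $(x;q)_\infty=\prod_{n\ge 0}(1-xq^n)$; for $n\in\mathbb Z$ let $(x;q)_n=(x;q)_\infty/(xq^n;q)_\infty$ (that is, $(x;q)_n=\prod_{i=0}^{n-1}(1-xq^i)$ for $n\ge0$ and $(x;q)_{-m}=1/\prod_{i=1}^{m}(1-xq^{-i})$ for $m\ge1$), and $(x_1,\dots,x_r;q)_n=\prod_i (x_i;q)_n$. For $x\ne0$ let $$\theta(x)=\frac1{(q;q)_\infty}\sum_{n=-\infty}^{\infty}(-1)^nq^{n(n-1)/2}x^n,\qquad \theta(x_1,\dots,x_r)=\prod_i\theta(x_i),$$ $$\Omega(x_1,\dots,x_n;a_1,\dots,a_m)=\prod_{i=1}^n\prod_{j=1}^m (x_i/a_j;q)_\infty .$$ Let ${}_r\psi_r[a;a_3,\dots,a_r;q,z]=\sum_{n=-\infty}^{\infty}\frac{(a_1,\dots,a_r;q)_n}{(aq/a_1,\dots,aq/a_r;q)_n}z^n$ with $a_1=q\sqrt a$, $a_2=-q\sqrt a$ denote the very-well-poised bilateral series. Let $b,c,d,e,f,g$ be nonzero complex numbers such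 that $|bc/fg|<1$ and $|(bc)^2/(defgq)|<1$. Assume that no denominator occurring below vanishes, that is: - for all integers $k\ge 1$: $bq^k\notin\{d,e,f,g\}$, $b\ne q^k$ and $c\neq q^k$; - for all integers $k\ge0$: $bcq^k\notin\{f,g,def,deg\}$; - for all $k\in\mathbb Z$: $q^k\notin\{d,\ e,\ de,\ de/b,\ de/c,\ de/(bc)\}$. Then the two series below converge absolutely and \begin{align*} \Omega(bq,c;f,g)&\sum_{n=0}^\infty\Bigl(1-\frac{bq^{2n+1}}{c}\Bigr)\frac{(dq/c,eq/c,fq/c,gq/c;q)_n}{(bq/d,bq/e,bq/f,bq/g;q)_n}\Bigl(\frac{(bc)^2}{defgq}\Bigr)^n\\ &=\kappa_2(b)\,\frac{\theta(deq/c,de/b)}{\theta(deq/bc,de)}\,\frac{\Omega(q;b,c)\,\Omega(bc;f,g,de,fg,def,deg)}{\Omega(1/de;1/b,1/c,fgq/(bc)^2)}\\ &\qquad\times{}_8\psi_8\bigl[de;b,c,d,e,defq/bc,degq/bc;q,bc/fg\bigr]\\ &\quad+\frac{\theta(1/b,deq/b)}{\theta(1/d,1/e)}\,\frac{\Omega(q/c;1/c,1/d,1/e)\,\Omega(bc;df,dg,ef,eg,fg)}{\Omega\bigl(1/de;1/bdq,1/beq,bc/((de)^2q),fgq/(bc)^2\bigr)},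 \end{align*} where $$\kappa_2(b)=\frac{(1-b/d)(1-b/e)(1-1/de)}{(1-1/d)(1-1/e)\,(q;q)_\infty}.$$ -/

import Mathlib

namespace QSeries

/-- The infinite `q`-shifted factorial `(x; q)_∞ = ∏_{n ≥ 0} (1 - x q^n)`. -/
noncomputable def pochInf (q x : ℂ) : ℂ :=
  ∏' n : ℕ, (1 - x * q ^ n)

/-- The `q`-shifted factorial `(x; q)_n = (x; q)_∞ / (x q^n; q)_∞` for an integer `n`, with the
quotient written as the finite product to which it reduces, so that it also has its usual value
when `x` is a power of `q` and both infinite products vanish: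
`(x; q)_n = ∏_{0 ≤ i < n} (1 - x q^i)` and `(x; q)_{-m} = 1 / ∏_{1 ≤ i ≤ m} (1 - x q^{-i})`. -/
noncomputable def poch (q x : ℂ) : ℤ → ℂ
  | Int.ofNat n => ∏ i ∈ Finset.range n, (1 - x * q ^ i)
  | Int.negSucc m => (∏ i ∈ Finset.range (m + 1), (1 - x / q ^ (i + 1)))⁻¹

/-- `(x_1, …, x_r; q)_n = (x_1; q)_n ⋯ (x_r; q)_n`. -/
noncomputable def pochProd (q : ℂ) (xs : List ℂ) (n : ℤ) : ℂ :=
  (xs.map fun x => poch q x n).prod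

/-- The Jacobi theta function
`θ(x) = (q; q)_∞⁻¹ ∑_{n ∈ ℤ} (-1)^n q^{n (n - 1) / 2} x^n` (the division in the exponent is
exact). -/
noncomputable def theta (q x : ℂ) : ℂ :=
  1 / pochInf q q * ∑' n : ℤ, (-1 : ℂ) ^ n * q ^ (n * (n - 1) / 2) * x ^ n

/-- `θ(x_1, …, x_r) = θ(x_1) ⋯ θ(x_r)`. -/
noncomputable def thetaProd (q : ℂ) (xs : List ℂ) : ℂ :=
  (xs.map fun x => theta q x).prod

/-- `Ω(x_1, …, x_n; a_1, …, a_m) = ∏_i ∏_j (x_i / a_j; q)_∞`. -/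
noncomputable def Omega (q : ℂ) (xs as : List ℂ) : ℂ :=
  (xs.map fun x => (as.map fun a => pochInf q (x / a)).prod).prod

/-- The `n`-th term of the bilateral series with upper parameters `as`, lower parameters `bs`,
base `q` and argument `z`. -/
noncomputable def psiTerm (as bs : List ℂ) (q z : ℂ) (n : ℤ) : ℂ :=
  pochProd q as n / pochProd q bs n * z ^ n

/-- The upper parameters `q √a, -q √a, a_3, …, a_r` of a very-well-poised series. -/
noncomputable def vwpUpper (a : ℂ) (ps : List ℂ) (q : ℂ) : List ℂ :=
  (q * a ^ (1 / 2 : ℂ)) :: (-(q * a ^ (1 / 2 : ℂ))) :: ps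

/-- The `n`-th term of the very-well-poised bilateral series `_rψ_r[a; a_3, …, a_r; q, z]`, where
`ps = [a_3, …, a_r]` and every lower parameter is `a q` divided by the upper one. -/
noncomputable def vwpPsiTerm (a : ℂ) (ps : List ℂ) (q z : ℂ) (n : ℤ) : ℂ :=
  psiTerm (vwpUpper a ps q) ((vwpUpper a ps q).map fun u => a * q / u) q z n

/-- The very-well-poised bilateral series `_rψ_r[a; a_3, …, a_r; q, z]`. -/
noncomputable def vwpPsi (a : ℂ) (ps : List ℂ) (q z : ℂ) : ℂ :=
  ∑' n : ℤ, vwpPsiTerm a ps q z n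

/-- `κ₂(b) = (1 - b/d)(1 - b/e)(1 - 1/(d e)) / ((1 - 1/d)(1 - 1/e) (q; q)_∞)`. -/
noncomputable def kappa₂ (q b d e : ℂ) : ℂ :=
  (1 - b / d) * (1 - b / e) * (1 - 1 / (d * e)) /
    ((1 - 1 / d) * (1 - 1 / e) * pochInf q q)

/-- The `n`-th term of the unilateral series
`∑ (1 - b q^{2n+1}/c) (dq/c, eq/c, fq/c, gq/c; q)_n / (bq/d, bq/e, bq/f, bq/g; q)_n
  ((b c)² / (d e f g q))^n`. -/
noncomputable def uniTerm (q b c d e f g : ℂ) (n : ℕ) : ℂ :=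
  (1 - b * q ^ (2 * n + 1) / c) *
    (pochProd q [d * q / c, e * q / c, f * q / c, g * q / c] n /
      pochProd q [b * q / d, b * q / e, b * q / f, b * q / g] n) *
    ((b * c) ^ 2 / (d * e * f * g * q)) ^ n

end QSeries

/-
Normalized so as to be entire in the reciprocals `y_i` of its parameters, the very-well-poised
`₆ψ₆` series satisfies a contiguous relation in `y₁ ↦ q y₁`, obtained by summing a telescoping
difference. Iterating it in every `y_i` reduces the series to its value at `y = 0`, which a
terminating case determines; this is Bailey's sum. At `y = 0` the series is also the theta series
with its terms of even and odd index grouped in pairs, so the same evaluation contains Jacobi's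
triple product.

For `a = d e` the shift `(y₁, y₂) ↦ (y₁ / q, q y₂)` changes the `₈ψ₈` series by a multiple of a
`₆ψ₆` series. Summed by Bailey's formula, the consecutive differences are the terms of the
unilateral series, which is therefore the unshifted `₈ψ₈` series minus the limit of its shifts.
Quasi-periodicity of `θ` makes the shifted well-poised factors converge to a product of theta
functions, which leaves in the limit a `₆ψ₆` series with parameters `d` and `e`: it gives the second
term of the formula.
-/

open Filter Topology

namespace QSeries

section InfiniteProduct

variable {q : ℂ}

lemma summable_norm_mul_pow (hq : ‖q‖ < 1) (x : ℂ) : Summable fun n : ℕ => ‖-(x * q ^ n)‖ := by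
  simpa [norm_mul, norm_pow] using
    (summable_geometric_of_lt_one (norm_nonneg q) hq).mul_left ‖x‖

lemma multipliable_one_sub_mul_pow (hq : ‖q‖ < 1) (x : ℂ) :
    Multipliable fun n : ℕ => 1 - x * q ^ n := by
  simpa [sub_eq_add_neg] using multipliable_one_add_of_summable (summable_norm_mul_pow hq x)

@[simp]
lemma pochInf_zero (q : ℂ) : pochInf q 0 = 1 := by
  simp [pochInf]

lemma pochInf_eq_prod_mul (hq : ‖q‖ < 1) (x : ℂ) (N : ℕ) :
    pochInf q x = (∏ i ∈ Finset.range N, (1 - x * q ^ i)) * pochInf q (x * q ^ N) := by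
  have hmul : Multipliable fun n : ℕ => 1 - x * q ^ (n + N) := by
    simpa only [pow_add, mul_assoc, mul_comm] using multipliable_one_sub_mul_pow hq (x * q ^ N)
  have hsplit := Multipliable.prod_mul_tprod_nat_mul' (f := fun n => 1 - x * q ^ n) hmul
  simpa only [pochInf, pow_add, mul_assoc, mul_comm] using hsplit.symm

lemma pochInf_eq_mul (hq : ‖q‖ < 1) (x : ℂ) : pochInf q x = (1 - x) * pochInf q (x * q) := by
  simpa using pochInf_eq_prod_mul hq x 1

lemma pochInf_zpow (hq0 : q ≠ 0) (hq : ‖q‖ < 1) (x : ℂ) (n : ℤ) :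
    pochInf q (q ^ n * x) = (1 - q ^ n * x) * pochInf q (q ^ (n + 1) * x) := by
  rw [pochInf_eq_mul hq, zpow_add_one₀ hq0, mul_right_comm]

lemma norm_prod_sub_one_le (hq : ‖q‖ < 1) (x : ℂ) (N : ℕ) :
    ‖∏ i ∈ Finset.range N, (1 - x * q ^ i) - 1‖ ≤ Real.exp (‖x‖ / (1 - ‖q‖)) - 1 := by
  have h := Finset.norm_prod_one_add_sub_one_le (Finset.range N) fun i : ℕ => -(x * q ^ i)
  simp only [← sub_eq_add_neg] at h
  refine h.trans (sub_le_sub_right (Real.exp_le_exp.2 ?_) 1)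
  refine ((summable_norm_mul_pow hq x).sum_le_tsum _ fun _ _ => norm_nonneg _).trans_eq ?_
  simp only [norm_neg, norm_mul, norm_pow]
  rw [tsum_mul_left, tsum_geometric_of_lt_one (norm_nonneg q) hq, div_eq_mul_inv]

lemma norm_pochInf_sub_one_le (hq : ‖q‖ < 1) (x : ℂ) :
    ‖pochInf q x - 1‖ ≤ Real.exp (‖x‖ / (1 - ‖q‖)) - 1 :=
  le_of_tendsto ((multipliable_one_sub_mul_pow hq x).tendsto_prod_tprod_nat.sub_const 1).norm
    (Eventually.of_forall fun N => norm_prod_sub_one_le hq x N)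

lemma norm_pochInf_le (hq : ‖q‖ < 1) (x : ℂ) :
    ‖pochInf q x‖ ≤ Real.exp (‖x‖ / (1 - ‖q‖)) := by
  have htriangle := norm_add_le (pochInf q x - 1) 1
  have hsub := norm_pochInf_sub_one_le hq x
  simp only [sub_add_cancel, norm_one] at htriangle
  linarith

lemma tendsto_pochInf_one {ι : Type*} {l : Filter ι} (hq : ‖q‖ < 1) {u : ι → ℂ}
    (hu : Tendsto u l (𝓝 0)) : Tendsto (fun i => pochInf q (u i)) l (𝓝 1) := by
  rw [tendsto_iff_norm_sub_tendsto_zero]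
  refine squeeze_zero (fun _ => norm_nonneg _) (fun i => norm_pochInf_sub_one_le hq (u i)) ?_
  have hexp : Tendsto (fun i => Real.exp (‖u i‖ / (1 - ‖q‖)) - 1) l
      (𝓝 (Real.exp (‖(0 : ℂ)‖ / (1 - ‖q‖)) - 1)) :=
    ((Real.continuous_exp.tendsto _).comp (hu.norm.div_const _)).sub_const 1
  simpa using hexp

lemma pochInf_ne_zero (hq : ‖q‖ < 1) {x : ℂ} (hx : ∀ k : ℕ, x * q ^ k ≠ 1) :
    pochInf q x ≠ 0 := by
  have h := tprod_one_add_ne_zero_of_summable (f := fun n : ℕ => -(x * q ^ n))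
    (fun i => by rw [← sub_eq_add_neg]; exact sub_ne_zero.2 (hx i).symm)
    (summable_norm_mul_pow hq x)
  simpa [pochInf, sub_eq_add_neg] using h

lemma pochInf_div_ne_zero (hq : ‖q‖ < 1) {u v : ℂ} (hv : v ≠ 0) (h : ∀ k : ℕ, u * q ^ k ≠ v) :
    pochInf q (u / v) ≠ 0 :=
  pochInf_ne_zero hq fun k hk => h k (by rwa [div_mul_eq_mul_div, div_eq_one_iff_eq hv] at hk)

lemma pochInf_q_div_ne_zero (hq : ‖q‖ < 1) {x : ℂ} (hx0 : x ≠ 0)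
    (hx : ∀ k : ℕ, x ≠ q ^ (k + 1)) : pochInf q (q / x) ≠ 0 :=
  pochInf_div_ne_zero hq hx0 fun k => by
    rw [← pow_succ']
    exact (hx k).symm

lemma pochInf_mul_q_div_ne_zero {u v : ℂ} (hq0 : q ≠ 0) (hq : ‖q‖ < 1) (hv : v ≠ 0)
    (h : ∀ k : ℤ, u ≠ v * q ^ k) : pochInf q (u * q / v) ≠ 0 := by
  refine pochInf_div_ne_zero hq hv fun k hk => h (-(k + 1 : ℕ)) ?_
  rw [zpow_neg, zpow_natCast, ← hk, mul_assoc u, ← pow_succ',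
    mul_inv_cancel_right₀ (pow_ne_zero _ hq0)]

lemma pochInf_ne_zero_of_norm_lt_one (hq : ‖q‖ < 1) {x : ℂ} (hx : ‖x‖ < 1) :
    pochInf q x ≠ 0 := by
  refine pochInf_ne_zero hq fun k hk => ?_
  have hlt : ‖x * q ^ k‖ < 1 := by
    rw [norm_mul, norm_pow]
    exact mul_lt_one_of_nonneg_of_lt_one_left (norm_nonneg x) hx
      (pow_le_one₀ (norm_nonneg q) hq.le)
  simp [hk] at hlt

lemma pochInf_eq_zero (hq : ‖q‖ < 1) {x : ℂ} (k : ℕ) (hx : x * q ^ k = 1) : pochInf q x = 0 := by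
  simp [pochInf_eq_prod_mul hq x (k + 1), Finset.prod_range_succ, hx]

end InfiniteProduct

section Triangular

/-- The triangular number `n (n - 1) / 2` of an integer, the exponent of `q` in the theta
series. -/
def tri (n : ℤ) : ℤ := n * (n - 1) / 2

lemma two_mul_tri (n : ℤ) : 2 * tri n = n * (n - 1) :=
  Int.mul_ediv_cancel' (Int.even_mul_pred_self n).two_dvd

@[simp]
lemma tri_zero : tri 0 = 0 := rfl

lemma tri_add_one (n : ℤ) : tri (n + 1) = tri n + n := by
  linarith [two_mul_tri n, two_mul_tri (n + 1)]

lemma tri_two_mul (n : ℤ) : tri (2 * n) = 2 * n ^ 2 - n := by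
  linarith [two_mul_tri (2 * n)]

lemma tri_two_mul_add_one (n : ℤ) : tri (2 * n + 1) = 2 * n ^ 2 + n := by
  linarith [two_mul_tri (2 * n + 1)]

end Triangular

section Bounds

variable {q : ℂ}

lemma norm_pochInf_zpow_one_sub_le_prod (hq0 : q ≠ 0) (hq : ‖q‖ < 1) {Y : ℝ} (hY : 0 < Y) {y : ℂ}
    (hy : ‖y‖ ≤ Y) (m : ℕ) :
    ‖pochInf q (q ^ (1 - (m : ℤ)) * y)‖ ≤ Real.exp (Y / (1 - ‖q‖)) *
      (∏ i ∈ Finset.range m, (1 + Y⁻¹ * ‖q‖ ^ i)) * (Y ^ m * ‖q‖ ^ (-tri m)) := by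
  have hr : 0 < ‖q‖ := norm_pos_iff.2 hq0
  induction m with
  | zero =>
    simp only [Nat.cast_zero, sub_zero, zpow_one, Finset.range_zero, Finset.prod_empty, mul_one,
      pow_zero, tri_zero, neg_zero, zpow_zero]
    refine (norm_pochInf_le hq _).trans (Real.exp_le_exp.2 ?_)
    gcongr
    rw [norm_mul]
    nlinarith [norm_nonneg y]
  | succ m ih =>
    have hfactor : ‖1 - q ^ (-(m : ℤ)) * y‖ ≤
        (1 + Y⁻¹ * ‖q‖ ^ m) * (Y * ‖q‖ ^ (-(m : ℤ))) := calc
      _ ≤ 1 + ‖q‖ ^ (-(m : ℤ)) * Y := by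
        refine (norm_sub_le _ _).trans ?_
        rw [norm_one, norm_mul, norm_zpow]
        gcongr
      _ = _ := by
        rw [zpow_neg, zpow_natCast]
        field_simp
        ring
    rw [show (1 - ((m + 1 : ℕ) : ℤ)) = -(m : ℤ) by push_cast; ring, pochInf_zpow hq0 hq, norm_mul,
      neg_add_eq_sub]
    refine (mul_le_mul hfactor ih (norm_nonneg _) (by positivity)).trans_eq ?_
    rw [Finset.prod_range_succ, Nat.cast_succ, tri_add_one, neg_add, zpow_add₀ hr.ne']
    ring

lemma prod_one_add_mul_pow_le_exp {r : ℝ} (hr : 0 ≤ r) (hr1 : r < 1) {c : ℝ} (hc : 0 ≤ c) (m : ℕ) :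
    ∏ i ∈ Finset.range m, (1 + c * r ^ i) ≤ Real.exp (c / (1 - r)) := by
  refine (Real.prod_one_add_le_exp_sum _ fun i => by positivity).trans (Real.exp_le_exp.2 ?_)
  rw [← Finset.mul_sum, div_eq_mul_inv, ← tsum_geometric_of_lt_one hr hr1]
  gcongr
  exact (summable_geometric_of_lt_one hr hr1).sum_le_tsum _ fun _ _ => by positivity

lemma norm_pochInf_zpow_one_add_le (hq : ‖q‖ < 1) {Y : ℝ} {y : ℂ} (hy : ‖y‖ ≤ Y) (m : ℕ) :
    ‖pochInf q (q ^ (1 + (m : ℤ)) * y)‖ ≤ Real.exp (Y / (1 - ‖q‖)) := by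
  refine (norm_pochInf_le hq _).trans (Real.exp_le_exp.2 ?_)
  gcongr
  calc ‖q ^ (1 + (m : ℤ)) * y‖ = ‖q‖ ^ (1 + m) * ‖y‖ := by
        rw [norm_mul, norm_zpow, ← Nat.cast_one, ← Nat.cast_add, zpow_natCast]
    _ ≤ 1 * ‖y‖ := by
        gcongr
        exact pow_le_one₀ (norm_nonneg q) hq.le
    _ ≤ Y := by rwa [one_mul]

lemma exists_norm_pochInf_mul_pochInf_le (hq0 : q ≠ 0) (hq : ‖q‖ < 1) {U : ℝ} (hU : 0 < U)
    (V : ℝ) :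
    ∃ C > 0, ∀ u v : ℂ, ‖u‖ ≤ U → ‖v‖ ≤ V → ∀ m : ℕ,
      ‖pochInf q (q ^ (1 - (m : ℤ)) * u) * pochInf q (q ^ (1 + (m : ℤ)) * v)‖ ≤
        C * (U ^ m * ‖q‖ ^ (-tri m)) := by
  refine ⟨Real.exp (U / (1 - ‖q‖)) * Real.exp (U⁻¹ / (1 - ‖q‖)) * Real.exp (V / (1 - ‖q‖)),
    by positivity, fun u v hu hv m => ?_⟩
  rw [norm_mul, mul_right_comm]
  gcongr
  · refine (norm_pochInf_zpow_one_sub_le_prod hq0 hq hU hu m).trans ?_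
    gcongr
    exact prod_one_add_mul_pow_le_exp (norm_nonneg q) hq (inv_nonneg.2 hU.le) m
  · exact norm_pochInf_zpow_one_add_le hq hv m

end Bounds

section WellPoised

variable {q a : ℂ}

/-- The well-poised factor `(q^{1-n} y, a q^{1+n} y; q)_∞`. With `y = 1 / u` it is, up to
elementary factors, the quotient `(u; q)_n / (a q / u; q)_n` of a well-poised series, but it is
entire in `y`. -/
noncomputable def wpFactor (q a y : ℂ) (n : ℤ) : ℂ :=
  pochInf q (q ^ (1 - n) * y) * pochInf q (q ^ (1 + n) * (a * y))

/-- Two well-poised factors with the Gaussian weight that balances their growth. -/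
noncomputable def wpPair (q a y z : ℂ) (n : ℤ) : ℂ :=
  a ^ n * q ^ (n ^ 2) * (wpFactor q a y n * wpFactor q a z n)

/-- Four well-poised factors with the Gaussian weight that balances their growth. -/
noncomputable def wpQuad (q a y₁ y₂ y₃ y₄ : ℂ) (n : ℤ) : ℂ :=
  wpPair q a y₁ y₂ n * wpPair q a y₃ y₄ n

lemma wpFactor_eq_mul (hq0 : q ≠ 0) (hq : ‖q‖ < 1) (a y : ℂ) (n : ℤ) :
    wpFactor q a y n =
      (1 - q ^ (1 - n) * y) * (1 - q ^ (1 + n) * (a * y)) * wpFactor q a (q * y) n := by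
  rw [wpFactor, wpFactor, pochInf_zpow hq0 hq y, pochInf_zpow hq0 hq (a * y), zpow_add_one₀ hq0,
    zpow_add_one₀ hq0]
  ring_nf

lemma wpFactor_div_self (hq0 : q ≠ 0) (hq : ‖q‖ < 1) (a y : ℂ) (n : ℤ) :
    wpFactor q (a / q) y n = (1 - q ^ n * (a * y)) * wpFactor q a y n := by
  have hshift : q ^ (1 + n) * (a / q * y) = q ^ n * (a * y) := by
    rw [add_comm, zpow_add_one₀ hq0]
    field_simp
  rw [wpFactor, wpFactor, hshift, pochInf_zpow hq0 hq (a * y), add_comm n 1]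
  ring

lemma wpFactor_div_self_add_one (hq0 : q ≠ 0) (hq : ‖q‖ < 1) (a y : ℂ) (n : ℤ) :
    wpFactor q (a / q) y (n + 1) = (1 - q ^ (-n) * y) * wpFactor q a y n := by
  have hshift : q ^ (1 + (n + 1)) * (a / q * y) = q ^ (1 + n) * (a * y) := by
    rw [← add_assoc, zpow_add_one₀ hq0]
    field_simp
  rw [wpFactor, wpFactor, hshift, show 1 - (n + 1) = -n by ring, pochInf_zpow hq0 hq y,
    neg_add_eq_sub]
  ring

lemma wpFactor_neg (ha : a ≠ 0) (q y : ℂ) (n : ℤ) :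
    wpFactor q a y (-n) = wpFactor q a⁻¹ (a * y) n := by
  rw [wpFactor, wpFactor, inv_mul_cancel_left₀ ha, sub_neg_eq_add, ← sub_eq_add_neg, mul_comm]

lemma wpPair_neg (ha : a ≠ 0) (q y z : ℂ) (n : ℤ) :
    wpPair q a y z (-n) = wpPair q a⁻¹ (a * y) (a * z) n := by
  rw [wpPair, wpPair, wpFactor_neg ha, wpFactor_neg ha, inv_zpow', neg_sq]

lemma exists_norm_wpFactor_le (hq0 : q ≠ 0) (hq : ‖q‖ < 1) (a : ℂ) {Y : ℝ} (hY : 0 < Y) :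
    ∃ C > 0, ∀ y : ℂ, ‖y‖ ≤ Y → ∀ m : ℕ,
      ‖wpFactor q a y m‖ ≤ C * (Y ^ m * ‖q‖ ^ (-tri m)) := by
  obtain ⟨C, hC, hbound⟩ := exists_norm_pochInf_mul_pochInf_le hq0 hq hY (‖a‖ * Y)
  refine ⟨C, hC, fun y hy m => hbound y (a * y) hy ?_ m⟩
  rw [norm_mul]
  gcongr

lemma exists_norm_wpPair_natCast_le (hq0 : q ≠ 0) (hq : ‖q‖ < 1) (a : ℂ) {Y Z : ℝ} (hY : 0 < Y)
    (hZ : 0 < Z) :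
    ∃ C > 0, ∀ y z : ℂ, ‖y‖ ≤ Y → ‖z‖ ≤ Z → ∀ m : ℕ,
      ‖wpPair q a y z m‖ ≤ C * (‖a‖ * ‖q‖ * (Y * Z)) ^ m := by
  obtain ⟨C, hC, hy⟩ := exists_norm_wpFactor_le hq0 hq a hY
  obtain ⟨D, hD, hz⟩ := exists_norm_wpFactor_le hq0 hq a hZ
  have hr : 0 < ‖q‖ := norm_pos_iff.2 hq0
  have hweight (m : ℕ) : ‖q‖ ^ ((m : ℤ) ^ 2) * (‖q‖ ^ (-tri m) * ‖q‖ ^ (-tri m)) = ‖q‖ ^ m := by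
    rw [← zpow_add₀ hr.ne', ← zpow_add₀ hr.ne', ← zpow_natCast]
    congr 1
    linarith [two_mul_tri m]
  refine ⟨C * D, by positivity, fun y z hyY hzZ m => ?_⟩
  calc ‖wpPair q a y z m‖
      = ‖a‖ ^ m * ‖q‖ ^ ((m : ℤ) ^ 2) * (‖wpFactor q a y m‖ * ‖wpFactor q a z m‖) := by
        simp only [wpPair, norm_mul, norm_zpow, zpow_natCast, norm_pow]
    _ ≤ ‖a‖ ^ m * ‖q‖ ^ ((m : ℤ) ^ 2) * ((C * (Y ^ m * ‖q‖ ^ (-tri m))) *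
        (D * (Z ^ m * ‖q‖ ^ (-tri m)))) := by
        gcongr
        exacts [hy y hyY m, hz z hzZ m]
    _ = C * D * (‖a‖ ^ m * (‖q‖ ^ ((m : ℤ) ^ 2) * (‖q‖ ^ (-tri m) * ‖q‖ ^ (-tri m))) *
        (Y ^ m * Z ^ m)) := by ring
    _ = C * D * (‖a‖ * ‖q‖ * (Y * Z)) ^ m := by
        rw [hweight]
        ring

lemma exists_norm_wpPair_le (hq0 : q ≠ 0) (hq : ‖q‖ < 1) (ha : a ≠ 0) {Y Z : ℝ} (hY : 0 < Y)
    (hZ : 0 < Z) :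
    ∃ C > 0, ∀ y z : ℂ, ‖y‖ ≤ Y → ‖z‖ ≤ Z → ∀ n : ℤ,
      ‖wpPair q a y z n‖ ≤ C * (‖a‖ * ‖q‖ * (Y * Z)) ^ n.natAbs := by
  have ha' : 0 < ‖a‖ := norm_pos_iff.2 ha
  obtain ⟨C, hC, hpos⟩ := exists_norm_wpPair_natCast_le hq0 hq a hY hZ
  obtain ⟨D, -, hneg⟩ :=
    exists_norm_wpPair_natCast_le hq0 hq a⁻¹ (mul_pos ha' hY) (mul_pos ha' hZ)
  have hscale : ‖a⁻¹‖ * ‖q‖ * (‖a‖ * Y * (‖a‖ * Z)) = ‖a‖ * ‖q‖ * (Y * Z) := by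
    rw [norm_inv]
    field_simp
  refine ⟨max C D, lt_max_of_lt_left hC, fun y z hyY hzZ n => ?_⟩
  obtain ⟨m, rfl | rfl⟩ := Int.eq_nat_or_neg n
  · refine (hpos y z hyY hzZ m).trans ?_
    rw [Int.natAbs_natCast]
    gcongr
    exact le_max_left C D
  · have hbound := hneg (a * y) (a * z) (by rw [norm_mul]; gcongr) (by rw [norm_mul]; gcongr) m
    rw [hscale] at hbound
    rw [wpPair_neg ha, Int.natAbs_neg, Int.natAbs_natCast]
    refine hbound.trans ?_
    gcongr
    exact le_max_right C D

lemma exists_norm_wpQuad_le (hq0 : q ≠ 0) (hq : ‖q‖ < 1) (ha : a ≠ 0) {Y₁ Y₂ Y₃ Y₄ : ℝ}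
    (h₁ : 0 < Y₁) (h₂ : 0 < Y₂) (h₃ : 0 < Y₃) (h₄ : 0 < Y₄) :
    ∃ C > 0, ∀ y₁ y₂ y₃ y₄ : ℂ, ‖y₁‖ ≤ Y₁ → ‖y₂‖ ≤ Y₂ → ‖y₃‖ ≤ Y₃ → ‖y₄‖ ≤ Y₄ → ∀ n : ℤ,
      ‖wpQuad q a y₁ y₂ y₃ y₄ n‖ ≤
        C * (‖a‖ ^ 2 * ‖q‖ ^ 2 * (Y₁ * Y₂ * Y₃ * Y₄)) ^ n.natAbs := by
  obtain ⟨C, hC, hC'⟩ := exists_norm_wpPair_le hq0 hq ha h₁ h₂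
  obtain ⟨D, hD, hD'⟩ := exists_norm_wpPair_le hq0 hq ha h₃ h₄
  refine ⟨C * D, by positivity, fun y₁ y₂ y₃ y₄ k₁ k₂ k₃ k₄ n => ?_⟩
  rw [wpQuad, norm_mul]
  refine (mul_le_mul (hC' _ _ k₁ k₂ n) (hD' _ _ k₃ k₄ n) (norm_nonneg _)
    (by positivity)).trans_eq ?_
  rw [mul_mul_mul_comm, ← mul_pow]
  ring_nf

lemma summable_pow_natAbs {ρ : ℝ} (h0 : 0 ≤ ρ) (h1 : ρ < 1) :
    Summable fun n : ℤ => ρ ^ n.natAbs := by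
  refine Summable.of_nat_of_neg ?_ ?_ <;> simpa using summable_geometric_of_lt_one h0 h1

lemma exists_pos_mul_prod_add_lt_one {c x₁ x₂ x₃ x₄ : ℝ} (h : c * (x₁ * x₂ * x₃ * x₄) < 1) :
    ∃ ε > 0, c * ((x₁ + ε) * (x₂ + ε) * (x₃ + ε) * (x₄ + ε)) < 1 := by
  have hcont : Continuous fun ε : ℝ => c * ((x₁ + ε) * (x₂ + ε) * (x₃ + ε) * (x₄ + ε)) := by
    fun_prop
  have hlt := (hcont.tendsto 0).eventually_lt_const (u := 1) (by simpa using h)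
  obtain ⟨ε, hε, hpos⟩ :=
    ((hlt.filter_mono (nhdsWithin_le_nhds (s := Set.Ioi 0))).and self_mem_nhdsWithin).exists
  exact ⟨ε, hpos, hε⟩

lemma exists_summable_norm_wpQuad_le (hq0 : q ≠ 0) (hq : ‖q‖ < 1) (ha : a ≠ 0) {ρ : ℝ}
    (hρ : 0 < ρ) {y₁ y₂ y₃ y₄ : ℂ} (h : ρ * ‖a ^ 2 * q ^ 2 * (y₁ * y₂ * y₃ * y₄)‖ < 1) :
    ∃ bound : ℤ → ℝ, Summable bound ∧ ∀ x₁ : ℂ, ‖x₁‖ ≤ ‖y₁‖ → ∀ n : ℤ,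
      ρ ^ n.natAbs * ‖wpQuad q a x₁ y₂ y₃ y₄ n‖ ≤ bound n := by
  simp only [norm_mul, norm_pow, ← mul_assoc ρ] at h
  obtain ⟨ε, hε, hlt⟩ := exists_pos_mul_prod_add_lt_one h
  obtain ⟨C, -, hbound⟩ := exists_norm_wpQuad_le hq0 hq ha (Y₁ := ‖y₁‖ + ε) (Y₂ := ‖y₂‖ + ε)
    (Y₃ := ‖y₃‖ + ε) (Y₄ := ‖y₄‖ + ε) (by positivity) (by positivity) (by positivity)
    (by positivity)
  refine ⟨_, (summable_pow_natAbs (by positivity) hlt).mul_left C, fun x₁ hx n => ?_⟩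
  refine (mul_le_mul_of_nonneg_left (hbound x₁ y₂ y₃ y₄ (by linarith) (by linarith) (by linarith)
    (by linarith) n) (by positivity)).trans_eq ?_
  rw [mul_left_comm, ← mul_pow]
  ring_nf

lemma summable_wpQuad (hq0 : q ≠ 0) (hq : ‖q‖ < 1) (ha : a ≠ 0) {y₁ y₂ y₃ y₄ : ℂ}
    (h : ‖a ^ 2 * q ^ 2 * (y₁ * y₂ * y₃ * y₄)‖ < 1) : Summable (wpQuad q a y₁ y₂ y₃ y₄) := by
  obtain ⟨bound, hsum, hle⟩ := exists_summable_norm_wpQuad_le hq0 hq ha one_pos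
    (by rwa [one_mul])
  exact hsum.of_norm_bounded fun n => by simpa using hle y₁ le_rfl n

lemma tendsto_wpFactor_mul_pow (hq : ‖q‖ < 1) (a y : ℂ) (n : ℤ) :
    Tendsto (fun N : ℕ => wpFactor q a (y * q ^ N) n) atTop (𝓝 (wpFactor q a 0 n)) := by
  have hone (c : ℂ) : Tendsto (fun N : ℕ => pochInf q (c * q ^ N)) atTop (𝓝 1) :=
    tendsto_pochInf_one hq <| by
      simpa using (tendsto_pow_atTop_nhds_zero_of_norm_lt_one hq).const_mul c
  simpa [wpFactor, mul_assoc] using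
    (hone (q ^ (1 - n) * y)).mul (hone (q ^ (1 + n) * (a * y)))

end WellPoised

section FinitePochhammer

variable {q : ℂ}

lemma poch_natCast (q x : ℂ) (n : ℕ) :
    poch q x n = ∏ i ∈ Finset.range n, (1 - x * q ^ i) := rfl

@[simp]
lemma poch_zero (q x : ℂ) : poch q x 0 = 1 := by
  simpa using poch_natCast q x 0

lemma poch_natCast_succ (q x : ℂ) (n : ℕ) :
    poch q x (n + 1 : ℕ) = poch q x n * (1 - x * q ^ n) :=
  Finset.prod_range_succ _ n

lemma tendsto_poch_natCast (hq : ‖q‖ < 1) (x : ℂ) :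
    Tendsto (fun N : ℕ => poch q x N) atTop (𝓝 (pochInf q x)) :=
  (multipliable_one_sub_mul_pow hq x).tendsto_prod_tprod_nat

end FinitePochhammer

section SixPsi

variable {q a : ℂ}

/-- The `n`-th term of the very-well-poised `₆ψ₆` series with parameters `1 / y_i`, normalized so
that it is entire in the `y_i`. -/
noncomputable def sixPsiTerm (q a y₁ y₂ y₃ y₄ : ℂ) (n : ℤ) : ℂ :=
  (q ^ (-n) - a * q ^ n) * wpQuad q a y₁ y₂ y₃ y₄ n

/-- The normalized very-well-poised `₆ψ₆` series with parameters `1 / y_i`. -/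
noncomputable def sixPsi (q a y₁ y₂ y₃ y₄ : ℂ) : ℂ :=
  ∑' n : ℤ, sixPsiTerm q a y₁ y₂ y₃ y₄ n

lemma norm_zpow_le_inv_pow_natAbs (hq0 : q ≠ 0) (hq : ‖q‖ < 1) (n : ℤ) :
    ‖q ^ n‖ ≤ ‖q‖⁻¹ ^ n.natAbs := by
  rw [norm_zpow, ← zpow_natCast, inv_zpow']
  exact zpow_le_zpow_right_of_le_one₀ (norm_pos_iff.2 hq0) hq.le (by omega)

lemma norm_zpow_neg_sub_le (hq0 : q ≠ 0) (hq : ‖q‖ < 1) (a : ℂ) (n : ℤ) :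
    ‖q ^ (-n) - a * q ^ n‖ ≤ (1 + ‖a‖) * ‖q‖⁻¹ ^ n.natAbs := by
  refine (norm_sub_le _ _).trans ?_
  rw [norm_mul, add_mul, one_mul]
  gcongr
  · simpa using norm_zpow_le_inv_pow_natAbs hq0 hq (-n)
  · exact norm_zpow_le_inv_pow_natAbs hq0 hq n

lemma inv_norm_mul_norm_eq (hq0 : q ≠ 0) (a y : ℂ) :
    ‖q‖⁻¹ * ‖a ^ 2 * q ^ 2 * y‖ = ‖a ^ 2 * q * y‖ := by
  have hr : ‖q‖ ≠ 0 := norm_ne_zero_iff.2 hq0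
  simp only [norm_mul, norm_pow]
  field_simp

lemma exists_summable_norm_sixPsiTerm_le (hq0 : q ≠ 0) (hq : ‖q‖ < 1) (ha : a ≠ 0)
    {y₁ y₂ y₃ y₄ : ℂ} (h : ‖a ^ 2 * q * (y₁ * y₂ * y₃ * y₄)‖ < 1) :
    ∃ bound : ℤ → ℝ, Summable bound ∧ ∀ x₁ : ℂ, ‖x₁‖ ≤ ‖y₁‖ → ∀ n,
      ‖sixPsiTerm q a x₁ y₂ y₃ y₄ n‖ ≤ bound n := by
  obtain ⟨bound, hsum, hle⟩ := exists_summable_norm_wpQuad_le hq0 hq ha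
    (inv_pos.2 (norm_pos_iff.2 hq0)) ((inv_norm_mul_norm_eq hq0 a _).trans_lt h)
  refine ⟨_, hsum.mul_left (1 + ‖a‖), fun x₁ hx n => ?_⟩
  rw [sixPsiTerm, norm_mul]
  refine (mul_le_mul_of_nonneg_right (norm_zpow_neg_sub_le hq0 hq a n) (norm_nonneg _)).trans ?_
  rw [mul_assoc]
  gcongr
  exact hle x₁ hx n

lemma summable_sixPsiTerm (hq0 : q ≠ 0) (hq : ‖q‖ < 1) (ha : a ≠ 0) {y₁ y₂ y₃ y₄ : ℂ}
    (h : ‖a ^ 2 * q * (y₁ * y₂ * y₃ * y₄)‖ < 1) : Summable (sixPsiTerm q a y₁ y₂ y₃ y₄) := by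
  obtain ⟨bound, hsum, hle⟩ := exists_summable_norm_sixPsiTerm_le hq0 hq ha h
  exact hsum.of_norm_bounded (hle y₁ le_rfl)

lemma sixPsiTerm_telescope (hq0 : q ≠ 0) (hq : ‖q‖ < 1) (ha : a ≠ 0) (y₁ y₂ y₃ y₄ : ℂ) (n : ℤ) :
    (1 - a ^ 2 * q * (y₁ * y₂ * y₃ * y₄)) * sixPsiTerm q a y₁ y₂ y₃ y₄ n -
      (1 - a * q * (y₁ * y₂)) * (1 - a * q * (y₁ * y₃)) * (1 - a * q * (y₁ * y₄)) *
        sixPsiTerm q a (q * y₁) y₂ y₃ y₄ n =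
      q * y₁ * wpQuad q (a / q) (q * y₁) y₂ y₃ y₄ (n + 1) -
        q * y₁ * wpQuad q (a / q) (q * y₁) y₂ y₃ y₄ n := by
  have hx : q ^ n ≠ 0 := zpow_ne_zero n hq0
  have hweight : (a / q) ^ n * q ^ (n ^ 2) = (q ^ n)⁻¹ * (a ^ n * q ^ (n ^ 2)) := by
    rw [div_zpow]
    ring
  have hweight_succ :
      (a / q) ^ (n + 1) * q ^ ((n + 1) ^ 2) = a * q ^ n * (a ^ n * q ^ (n ^ 2)) := by
    rw [div_zpow, show (n + 1) ^ 2 = n ^ 2 + (n + 1) + n by ring, zpow_add₀ hq0 _ n,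
      zpow_add₀ hq0 (n ^ 2), zpow_add_one₀ ha]
    field_simp [zpow_ne_zero (n + 1) hq0]
  simp only [sixPsiTerm, wpQuad, wpPair, hweight, hweight_succ,
    wpFactor_div_self_add_one hq0 hq]
  simp only [wpFactor_div_self hq0 hq, wpFactor_eq_mul hq0 hq a y₁, zpow_neg, zpow_sub₀ hq0,
    zpow_add₀ hq0, zpow_one]
  generalize a ^ n * q ^ (n ^ 2) = w
  generalize q ^ n = x at *
  field_simp
  ring

lemma tsum_int_add_one_sub {f : ℤ → ℂ} (hf : Summable f) : ∑' n : ℤ, (f (n + 1) - f n) = 0 := by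
  have hshift : Summable fun n : ℤ => f (n + 1) := (Equiv.addRight (1 : ℤ)).summable_iff.2 hf
  rw [hshift.tsum_sub hf, sub_eq_zero]
  exact (Equiv.addRight (1 : ℤ)).tsum_eq f

lemma norm_mul_pow_le (hq : ‖q‖ < 1) (x : ℂ) (N : ℕ) : ‖x * q ^ N‖ ≤ ‖x‖ := by
  rw [norm_mul, norm_pow]
  exact mul_le_of_le_one_right (norm_nonneg x) (pow_le_one₀ (norm_nonneg q) hq.le)

lemma sixPsi_contiguous (hq0 : q ≠ 0) (hq : ‖q‖ < 1) (ha : a ≠ 0) {y₁ y₂ y₃ y₄ : ℂ}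
    (h : ‖a ^ 2 * q * (y₁ * y₂ * y₃ * y₄)‖ < 1) :
    (1 - a ^ 2 * q * (y₁ * y₂ * y₃ * y₄)) * sixPsi q a y₁ y₂ y₃ y₄ =
      (1 - a * q * (y₁ * y₂)) * (1 - a * q * (y₁ * y₃)) * (1 - a * q * (y₁ * y₄)) *
        sixPsi q a (q * y₁) y₂ y₃ y₄ := by
  have h' : ‖a ^ 2 * q * ((q * y₁) * y₂ * y₃ * y₄)‖ < 1 := by
    rw [show a ^ 2 * q * ((q * y₁) * y₂ * y₃ * y₄) =
      a ^ 2 * q * (y₁ * y₂ * y₃ * y₄) * q ^ 1 by ring]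
    exact (norm_mul_pow_le hq _ 1).trans_lt h
  have hquad : Summable (wpQuad q (a / q) (q * y₁) y₂ y₃ y₄) := by
    refine summable_wpQuad hq0 hq (div_ne_zero ha hq0) ?_
    rwa [show (a / q) ^ 2 * q ^ 2 * ((q * y₁) * y₂ * y₃ * y₄) =
      a ^ 2 * q * (y₁ * y₂ * y₃ * y₄) by field_simp]
  have htelescope := tsum_int_add_one_sub (hquad.mul_left (q * y₁))
  simp only [← sixPsiTerm_telescope hq0 hq ha] at htelescope
  rw [((summable_sixPsiTerm hq0 hq ha h).mul_left _).tsum_sub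
    ((summable_sixPsiTerm hq0 hq ha h').mul_left _), tsum_mul_left, tsum_mul_left] at htelescope
  exact sub_eq_zero.1 htelescope

lemma sixPsi_contiguous_iterate (hq0 : q ≠ 0) (hq : ‖q‖ < 1) (ha : a ≠ 0) {y₁ y₂ y₃ y₄ : ℂ}
    (h : ‖a ^ 2 * q * (y₁ * y₂ * y₃ * y₄)‖ < 1) (N : ℕ) :
    poch q (a ^ 2 * q * (y₁ * y₂ * y₃ * y₄)) N * sixPsi q a y₁ y₂ y₃ y₄ =
      poch q (a * q * (y₁ * y₂)) N * poch q (a * q * (y₁ * y₃)) N *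
        poch q (a * q * (y₁ * y₄)) N * sixPsi q a (y₁ * q ^ N) y₂ y₃ y₄ := by
  induction N with
  | zero => simp
  | succ N ih =>
    have hN : ‖a ^ 2 * q * ((y₁ * q ^ N) * y₂ * y₃ * y₄)‖ < 1 := by
      rw [show a ^ 2 * q * ((y₁ * q ^ N) * y₂ * y₃ * y₄) =
        a ^ 2 * q * (y₁ * y₂ * y₃ * y₄) * q ^ N by ring]
      exact (norm_mul_pow_le hq _ N).trans_lt h
    have hcontiguous := sixPsi_contiguous hq0 hq ha hN
    rw [show q * (y₁ * q ^ N) = y₁ * q ^ (N + 1) by ring] at hcontiguous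
    simp only [poch_natCast_succ]
    linear_combination (1 - a ^ 2 * q * (y₁ * y₂ * y₃ * y₄) * q ^ N) * ih +
      poch q (a * q * (y₁ * y₂)) N * poch q (a * q * (y₁ * y₃)) N *
        poch q (a * q * (y₁ * y₄)) N * hcontiguous

lemma tendsto_sixPsi_mul_pow (hq0 : q ≠ 0) (hq : ‖q‖ < 1) (ha : a ≠ 0) {y₁ y₂ y₃ y₄ : ℂ}
    (h : ‖a ^ 2 * q * (y₁ * y₂ * y₃ * y₄)‖ < 1) :
    Tendsto (fun N : ℕ => sixPsi q a (y₁ * q ^ N) y₂ y₃ y₄) atTop (𝓝 (sixPsi q a 0 y₂ y₃ y₄)) := by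
  obtain ⟨bound, hsum, hle⟩ := exists_summable_norm_sixPsiTerm_le hq0 hq ha h
  refine tendsto_tsum_of_dominated_convergence hsum (fun n => ?_)
    (Eventually.of_forall fun N n => hle _ (norm_mul_pow_le hq y₁ N) n)
  simp only [sixPsiTerm, wpQuad, wpPair]
  exact ((((tendsto_wpFactor_mul_pow hq a y₁ n).mul_const _).const_mul _).mul_const _).const_mul _

lemma pochInf_mul_sixPsi (hq0 : q ≠ 0) (hq : ‖q‖ < 1) (ha : a ≠ 0) {y₁ y₂ y₃ y₄ : ℂ}
    (h : ‖a ^ 2 * q * (y₁ * y₂ * y₃ * y₄)‖ < 1) :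
    pochInf q (a ^ 2 * q * (y₁ * y₂ * y₃ * y₄)) * sixPsi q a y₁ y₂ y₃ y₄ =
      pochInf q (a * q * (y₁ * y₂)) * pochInf q (a * q * (y₁ * y₃)) *
        pochInf q (a * q * (y₁ * y₄)) * sixPsi q a 0 y₂ y₃ y₄ := by
  refine tendsto_nhds_unique ((tendsto_poch_natCast hq _).mul_const _) ?_
  simp only [sixPsi_contiguous_iterate hq0 hq ha h]
  exact (((tendsto_poch_natCast hq _).mul (tendsto_poch_natCast hq _)).mul
    (tendsto_poch_natCast hq _)).mul (tendsto_sixPsi_mul_pow hq0 hq ha h)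

lemma sixPsi_swap_left (q a y₁ y₂ y₃ y₄ : ℂ) :
    sixPsi q a y₁ y₂ y₃ y₄ = sixPsi q a y₂ y₁ y₃ y₄ := by
  simp only [sixPsi, sixPsiTerm, wpQuad, wpPair, mul_comm (wpFactor q a y₁ _)]

lemma sixPsi_swap_pairs (q a y₁ y₂ y₃ y₄ : ℂ) :
    sixPsi q a y₁ y₂ y₃ y₄ = sixPsi q a y₃ y₄ y₁ y₂ := by
  simp only [sixPsi, sixPsiTerm, wpQuad, mul_comm (wpPair q a y₁ y₂ _)]

lemma pochInf_mul_sixPsi_eq_mul_sixPsi_zero (hq0 : q ≠ 0) (hq : ‖q‖ < 1) (ha : a ≠ 0)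
    {y₁ y₂ y₃ y₄ : ℂ} (h : ‖a ^ 2 * q * (y₁ * y₂ * y₃ * y₄)‖ < 1) :
    pochInf q (a ^ 2 * q * (y₁ * y₂ * y₃ * y₄)) * sixPsi q a y₁ y₂ y₃ y₄ =
      pochInf q (a * q * (y₁ * y₂)) * pochInf q (a * q * (y₁ * y₃)) *
        pochInf q (a * q * (y₁ * y₄)) * pochInf q (a * q * (y₂ * y₃)) *
        pochInf q (a * q * (y₂ * y₄)) * pochInf q (a * q * (y₃ * y₄)) * sixPsi q a 0 0 0 0 := by
  have h₂ := pochInf_mul_sixPsi (y₁ := y₂) (y₂ := 0) (y₃ := y₃) (y₄ := y₄) hq0 hq ha (by simp)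
  have h₃ := pochInf_mul_sixPsi (y₁ := y₃) (y₂ := y₄) (y₃ := 0) (y₄ := 0) hq0 hq ha (by simp)
  have h₄ := pochInf_mul_sixPsi (y₁ := y₄) (y₂ := 0) (y₃ := 0) (y₄ := 0) hq0 hq ha (by simp)
  simp only [mul_zero, zero_mul, pochInf_zero, one_mul, mul_one] at h₂ h₃ h₄
  rw [pochInf_mul_sixPsi hq0 hq ha h, sixPsi_swap_left _ _ 0 y₂, h₂, sixPsi_swap_pairs _ _ 0 0, h₃,
    sixPsi_swap_left _ _ 0 y₄, h₄]
  ring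

lemma pochInf_zpow_eq_zero (hq0 : q ≠ 0) (hq : ‖q‖ < 1) {n : ℤ} (hn : n ≤ 0) :
    pochInf q (q ^ n) = 0 := by
  refine pochInf_eq_zero hq (-n).toNat ?_
  rw [← zpow_natCast, ← zpow_add₀ hq0, Int.toNat_of_nonneg (by omega), add_neg_cancel, zpow_zero]

lemma sixPsiTerm_one_inv (hq0 : q ≠ 0) (hq : ‖q‖ < 1) (ha : a ≠ 0) {n : ℤ} (hn : n ≠ 0)
    (y₃ y₄ : ℂ) : sixPsiTerm q a 1 a⁻¹ y₃ y₄ n = 0 := by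
  rcases lt_or_gt_of_ne hn with hn | hn
  · have hzero : wpFactor q a a⁻¹ n = 0 := by
      rw [wpFactor, mul_inv_cancel₀ ha, mul_one, pochInf_zpow_eq_zero hq0 hq (by omega), mul_zero]
    simp [sixPsiTerm, wpQuad, wpPair, hzero]
  · have hzero : wpFactor q a 1 n = 0 := by
      rw [wpFactor, mul_one, pochInf_zpow_eq_zero hq0 hq (by omega), zero_mul]
    simp [sixPsiTerm, wpQuad, wpPair, hzero]

/-- The constant is read off from the parameters `1` and `a`, for which the series reduces to its
`n = 0` term. -/
lemma sixPsi_zero (hq0 : q ≠ 0) (hq : ‖q‖ < 1) (ha : a ≠ 0) :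
    sixPsi q a 0 0 0 0 = pochInf q q * pochInf q a * pochInf q (q / a) := by
  have hsum : sixPsi q a 1 a⁻¹ 0 0 = sixPsiTerm q a 1 a⁻¹ 0 0 0 :=
    tsum_eq_single 0 fun n hn => sixPsiTerm_one_inv hq0 hq ha hn 0 0
  have hterm : sixPsiTerm q a 1 a⁻¹ 0 0 0 =
      (1 - a) * pochInf q q * pochInf q (q * a) * (pochInf q (q / a) * pochInf q q) := by
    simp [sixPsiTerm, wpQuad, wpPair, wpFactor, ha, div_eq_mul_inv]
    ring
  have hconst := pochInf_mul_sixPsi_eq_mul_sixPsi_zero (y₁ := 1) (y₂ := a⁻¹) (y₃ := 0) (y₄ := 0)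
    hq0 hq ha (by simp)
  rw [hsum, hterm, one_mul, mul_right_comm a, mul_inv_cancel₀ ha, one_mul] at hconst
  simp only [mul_zero, pochInf_zero, one_mul, mul_one] at hconst
  refine mul_left_cancel₀ (pochInf_ne_zero_of_norm_lt_one hq hq) (hconst.symm.trans ?_)
  rw [pochInf_eq_mul hq a, mul_comm q a]
  ring

end SixPsi

section Theta

variable {q x : ℂ}

lemma hasSum_int_even_add_odd {f : ℤ → ℂ} {s t : ℂ} (hs : HasSum (fun n : ℤ => f (2 * n)) s)
    (ht : HasSum (fun n : ℤ => f (2 * n + 1)) t) : HasSum f (s + t) := by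
  have heven : Function.Injective fun n : ℤ => 2 * n := mul_right_injective₀ two_ne_zero
  have hodd : Function.Injective fun n : ℤ => 2 * n + 1 := (add_left_injective 1).comp heven
  have hrange_even : (Set.range fun n : ℤ => 2 * n) = {n | Even n} := by
    ext n
    simp [even_iff_exists_two_mul]
  have hrange_odd : (Set.range fun n : ℤ => 2 * n + 1) = {n | Odd n} := by
    ext n
    exact ⟨fun ⟨k, hk⟩ => ⟨k, hk.symm⟩, fun ⟨k, hk⟩ => ⟨k, hk.symm⟩⟩
  refine (heven.hasSum_range_iff.2 hs).add_isCompl ?_ (hodd.hasSum_range_iff.2 ht)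
  rw [hrange_even, hrange_odd]
  exact Int.isCompl_even_odd

lemma wpQuad_zero (hq0 : q ≠ 0) (hx : x ≠ 0) (n : ℤ) :
    wpQuad q x 0 0 0 0 n = x ^ (2 * n) * q ^ (2 * n ^ 2) := by
  simp only [wpQuad, wpPair, wpFactor, mul_zero, pochInf_zero, mul_one]
  rw [two_mul, two_mul, zpow_add₀ hx, zpow_add₀ hq0]
  ring

lemma thetaTerm_two_mul (hq0 : q ≠ 0) (hx : x ≠ 0) (n : ℤ) :
    (-1 : ℂ) ^ (2 * n) * q ^ (tri (2 * n)) * x ^ (2 * n) = q ^ (-n) * wpQuad q x 0 0 0 0 n := by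
  rw [wpQuad_zero hq0 hx, tri_two_mul, sub_eq_neg_add, zpow_add₀ hq0, (even_two_mul n).neg_one_zpow]
  ring

lemma thetaTerm_two_mul_add_one (hq0 : q ≠ 0) (hx : x ≠ 0) (n : ℤ) :
    (-1 : ℂ) ^ (2 * n + 1) * q ^ (tri (2 * n + 1)) * x ^ (2 * n + 1) =
      -x * (q ^ n * wpQuad q x 0 0 0 0 n) := by
  rw [wpQuad_zero hq0 hx, tri_two_mul_add_one, add_comm _ n, zpow_add₀ hq0,
    (odd_two_mul_add_one n).neg_one_zpow, zpow_add_one₀ hx]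
  ring

/-- The terms of even and of odd index make up the two halves of the factor `q^{-n} - x q^n` of the
limiting `₆ψ₆` series. -/
lemma pochInf_mul_theta (hq0 : q ≠ 0) (hq : ‖q‖ < 1) (hx : x ≠ 0) :
    pochInf q q * theta q x = sixPsi q x 0 0 0 0 := by
  obtain ⟨bound, hsum, hle⟩ := exists_summable_norm_wpQuad_le (y₁ := 0) (y₂ := 0) (y₃ := 0)
    (y₄ := 0) hq0 hq hx (inv_pos.2 (norm_pos_iff.2 hq0)) (by simp)
  have hsummable {m : ℤ → ℤ} (hm : ∀ n, (m n).natAbs = n.natAbs) :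
      Summable fun n : ℤ => q ^ m n * wpQuad q x 0 0 0 0 n := by
    refine hsum.of_norm_bounded fun n => le_trans ?_ (hle 0 le_rfl n)
    rw [norm_mul, ← hm]
    gcongr
    exact norm_zpow_le_inv_pow_natAbs hq0 hq (m n)
  have heven := hsummable (m := fun n => -n) Int.natAbs_neg
  have hodd := (hsummable (m := fun n => n) fun _ => rfl).mul_left (-x)
  have htheta := hasSum_int_even_add_odd (f := fun n : ℤ => (-1 : ℂ) ^ n * q ^ tri n * x ^ n)
    (by simpa only [thetaTerm_two_mul hq0 hx] using heven.hasSum)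
    (by simpa only [thetaTerm_two_mul_add_one hq0 hx] using hodd.hasSum)
  rw [theta, one_div, mul_inv_cancel_left₀ (pochInf_ne_zero_of_norm_lt_one hq hq)]
  refine htheta.tsum_eq.trans ?_
  rw [← heven.tsum_add hodd, sixPsi]
  congr 1 with n
  rw [sixPsiTerm]
  ring

/-- **Jacobi's triple product identity.** -/
lemma theta_eq (hq0 : q ≠ 0) (hq : ‖q‖ < 1) (hx : x ≠ 0) :
    theta q x = pochInf q x * pochInf q (q / x) := by
  refine mul_left_cancel₀ (pochInf_ne_zero_of_norm_lt_one hq hq) ?_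
  rw [pochInf_mul_theta hq0 hq hx, sixPsi_zero hq0 hq hx, mul_assoc]

lemma theta_q_div (hq0 : q ≠ 0) (hq : ‖q‖ < 1) (hx : x ≠ 0) : theta q (q / x) = theta q x := by
  rw [theta_eq hq0 hq hx, theta_eq hq0 hq (div_ne_zero hq0 hx), div_div_cancel₀ hq0, mul_comm]

lemma theta_mul_q (hq0 : q ≠ 0) (hq : ‖q‖ < 1) (hx : x ≠ 0) :
    x * theta q (q * x) = -theta q x := by
  rw [theta_eq hq0 hq hx, theta_eq hq0 hq (mul_ne_zero hq0 hx), div_mul_cancel_left₀ hq0,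
    pochInf_eq_mul hq x, pochInf_eq_mul hq x⁻¹, mul_comm x q, inv_mul_eq_div]
  field_simp
  ring

lemma theta_eq_neg_mul_theta_one_div (hq0 : q ≠ 0) (hq : ‖q‖ < 1) (hx : x ≠ 0) :
    theta q x = -x * theta q (1 / x) := by
  rw [← theta_q_div hq0 hq (one_div_ne_zero hx), div_div_eq_mul_div, div_one]
  linear_combination theta_mul_q hq0 hq hx

lemma theta_mul_q_div {a : ℂ} (hq0 : q ≠ 0) (hq : ‖q‖ < 1) (ha : a ≠ 0) (hx : x ≠ 0) :
    theta q (a * q / x) = pochInf q (a * q / x) * pochInf q (x / a) := by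
  rw [theta_eq hq0 hq (by positivity)]
  congr 2
  field_simp

lemma theta_div {a : ℂ} (hq0 : q ≠ 0) (hq : ‖q‖ < 1) (ha : a ≠ 0) (hx : x ≠ 0) :
    theta q (a / x) = -(a / x) * (pochInf q (a * q / x) * pochInf q (x / a)) := by
  rw [theta_eq_neg_mul_theta_one_div hq0 hq (by positivity), one_div_div,
    ← theta_q_div hq0 hq (by positivity), div_div_eq_mul_div, mul_comm q,
    theta_mul_q_div hq0 hq ha hx]

lemma theta_zpow_mul (hq0 : q ≠ 0) (hq : ‖q‖ < 1) (hx : x ≠ 0) (m : ℤ) :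
    theta q (q ^ m * x) = (-x) ^ (-m) * q ^ (-tri m) * theta q x := by
  have hstep (m : ℤ) : theta q (q ^ (m + 1) * x) = -x⁻¹ * q ^ (-m) * theta q (q ^ m * x) := by
    have hqm : q ^ m ≠ 0 := zpow_ne_zero m hq0
    have h := theta_mul_q hq0 hq (mul_ne_zero hqm hx)
    rw [← neg_eq_iff_eq_neg] at h
    rw [← h, zpow_add_one₀ hq0, zpow_neg, mul_comm (q ^ m) q, mul_assoc q]
    field_simp
  have hcoeff (m : ℤ) : (-x) ^ (-(m + 1)) * q ^ (-tri (m + 1)) =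
      -x⁻¹ * q ^ (-m) * ((-x) ^ (-m) * q ^ (-tri m)) := by
    rw [tri_add_one, neg_add, neg_add, zpow_add₀ hq0, zpow_add₀ (neg_ne_zero.2 hx), zpow_neg_one,
      inv_neg]
    ring
  induction m with
  | zero => simp
  | succ m ih => rw [hstep, hcoeff, ih]; ring
  | pred m ih =>
    have h := hstep (-(m : ℤ) - 1)
    have h' := hcoeff (-(m : ℤ) - 1)
    rw [sub_add_cancel] at h h'
    rw [h, h', mul_assoc (-x⁻¹ * _)] at ih
    exact mul_left_cancel₀
      (mul_ne_zero (neg_ne_zero.2 (inv_ne_zero hx)) (zpow_ne_zero _ hq0)) ih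

lemma theta_ne_zero (hq0 : q ≠ 0) (hq : ‖q‖ < 1) (hx : x ≠ 0) (h : ∀ k : ℤ, x ≠ q ^ k) :
    theta q x ≠ 0 := by
  rw [theta_eq hq0 hq hx]
  refine mul_ne_zero (pochInf_ne_zero hq fun k hk => ?_) (pochInf_div_ne_zero hq hx fun k hk => ?_)
  · refine h (-k) ?_
    rw [zpow_neg, zpow_natCast]
    exact eq_inv_of_mul_eq_one_left hk
  · refine h (k + 1 : ℕ) ?_
    rw [zpow_natCast, pow_succ', hk]

end Theta

section Bailey

variable {q a : ℂ}

/-- **Bailey's summation of the very-well-poised `₆ψ₆` series.** -/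
lemma sixPsi_eq (hq0 : q ≠ 0) (hq : ‖q‖ < 1) (ha : a ≠ 0) {y₁ y₂ y₃ y₄ : ℂ}
    (h : ‖a ^ 2 * q * (y₁ * y₂ * y₃ * y₄)‖ < 1) :
    sixPsi q a y₁ y₂ y₃ y₄ = pochInf q q * theta q a *
      (pochInf q (a * q * (y₁ * y₂)) * pochInf q (a * q * (y₁ * y₃)) *
        pochInf q (a * q * (y₁ * y₄)) * pochInf q (a * q * (y₂ * y₃)) *
        pochInf q (a * q * (y₂ * y₄)) * pochInf q (a * q * (y₃ * y₄))) /
      pochInf q (a ^ 2 * q * (y₁ * y₂ * y₃ * y₄)) := by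
  rw [eq_div_iff (pochInf_ne_zero_of_norm_lt_one hq h), mul_comm (sixPsi ..),
    pochInf_mul_sixPsi_eq_mul_sixPsi_zero hq0 hq ha h, pochInf_mul_theta hq0 hq ha]
  ring

end Bailey

section IntegerPochhammer

variable {q x : ℂ}

lemma poch_neg_natCast (q x : ℂ) (n : ℕ) :
    poch q x (-n) = (∏ i ∈ Finset.range n, (1 - x / q ^ (i + 1)))⁻¹ := by
  cases n with
  | zero => simp
  | succ m => rfl

lemma poch_neg_natCast_inv (hq0 : q ≠ 0) (hx : x ≠ 0) (n : ℕ) :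
    (poch q x (-n))⁻¹ =
      (-x) ^ n * (∏ i ∈ Finset.range n, (q ^ (i + 1))⁻¹) * poch q (q / x) n := by
  rw [poch_neg_natCast, inv_inv, poch_natCast, ← Finset.card_range n, ← Finset.prod_const,
    Finset.card_range, ← Finset.prod_mul_distrib, ← Finset.prod_mul_distrib]
  refine Finset.prod_congr rfl fun i _ => ?_
  field_simp
  ring

lemma poch_neg_div_poch_neg {y : ℂ} (hq0 : q ≠ 0) (hx : x ≠ 0) (hy : y ≠ 0) (n : ℕ) :
    poch q x (-n) / poch q y (-n) = (y / x) ^ n * (poch q (q / y) n / poch q (q / x) n) := by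
  have hne : ∏ i ∈ Finset.range n, (q ^ (i + 1))⁻¹ ≠ 0 :=
    Finset.prod_ne_zero_iff.2 fun i _ => inv_ne_zero (pow_ne_zero _ hq0)
  rw [← inv_div_inv, poch_neg_natCast_inv hq0 hx, poch_neg_natCast_inv hq0 hy, mul_div_mul_comm,
    mul_div_mul_right _ _ hne, ← div_pow, neg_div_neg_eq]

lemma one_sub_mul_zpow_ne_zero (hx : ∀ k : ℤ, x ≠ q ^ k) (n : ℤ) : 1 - x * q ^ n ≠ 0 := by
  intro h
  refine hx (-n) ?_
  rw [zpow_neg]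
  exact eq_inv_of_mul_eq_one_left (sub_eq_zero.1 h).symm

lemma one_sub_div_pow_ne_zero (hq0 : q ≠ 0) {k : ℕ} (hx : x ≠ q ^ k) : 1 - x / q ^ k ≠ 0 := by
  rwa [sub_ne_zero, ne_comm, Ne, div_eq_one_iff_eq (pow_ne_zero k hq0)]

lemma poch_ne_zero (hx : ∀ k : ℤ, x ≠ q ^ k) (n : ℤ) : poch q x n ≠ 0 := by
  obtain ⟨m, rfl | rfl⟩ := Int.eq_nat_or_neg n
  · rw [poch_natCast]
    exact Finset.prod_ne_zero_iff.2 fun i _ => by exact_mod_cast one_sub_mul_zpow_ne_zero hx i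
  · rw [poch_neg_natCast]
    refine inv_ne_zero (Finset.prod_ne_zero_iff.2 fun i _ => ?_)
    have h := one_sub_mul_zpow_ne_zero hx (-((i + 1 : ℕ) : ℤ))
    rwa [zpow_neg, zpow_natCast, ← div_eq_mul_inv] at h

lemma poch_add_one (hq0 : q ≠ 0) (hx : ∀ k : ℕ, x ≠ q ^ (k + 1)) (n : ℤ) :
    poch q x (n + 1) = poch q x n * (1 - x * q ^ n) := by
  obtain ⟨m, rfl | rfl⟩ := Int.eq_nat_or_neg n
  · exact_mod_cast poch_natCast_succ q x m
  · cases m with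
    | zero => simpa using poch_natCast_succ q x 0
    | succ m =>
      rw [show -((m + 1 : ℕ) : ℤ) + 1 = -(m : ℤ) by push_cast; ring, poch_neg_natCast,
        poch_neg_natCast, Finset.prod_range_succ, zpow_neg, zpow_natCast, ← div_eq_mul_inv, mul_inv,
        inv_mul_cancel_right₀ (one_sub_div_pow_ne_zero hq0 (hx m))]

lemma poch_one_sub (hq0 : q ≠ 0) (hx : ∀ k : ℕ, x ≠ q ^ (k + 1)) (n : ℤ) :
    poch q x (1 - n) = poch q x (-n) * (1 - x * q ^ (-n)) := by
  rw [← poch_add_one hq0 hx, neg_add_eq_sub]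

lemma pochInf_div_pow (hq0 : q ≠ 0) (hq : ‖q‖ < 1) (x : ℂ) (n : ℕ) :
    pochInf q (x / q ^ n) = (poch q x (-n))⁻¹ * pochInf q x := by
  rw [poch_neg_natCast, inv_inv]
  induction n with
  | zero => simp
  | succ n ih =>
    have hshift : x / q ^ (n + 1) * q = x / q ^ n := by
      rw [pow_succ]
      field_simp
    rw [pochInf_eq_mul hq, hshift, ih, Finset.prod_range_succ]
    ring

lemma pochInf_mul_pow (hq : ‖q‖ < 1) (hx : pochInf q x ≠ 0) (n : ℕ) :
    pochInf q (x * q ^ n) = (poch q x n)⁻¹ * pochInf q x := by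
  have h := pochInf_eq_prod_mul hq x n
  rw [h] at hx
  rw [h, poch_natCast, inv_mul_cancel_left₀ (left_ne_zero_of_mul hx)]

lemma pochInf_zpow_mul (hq0 : q ≠ 0) (hq : ‖q‖ < 1) (hx : pochInf q x ≠ 0) (n : ℤ) :
    pochInf q (q ^ n * x) = (poch q x n)⁻¹ * pochInf q x := by
  obtain ⟨m, rfl | rfl⟩ := Int.eq_nat_or_neg n
  · rw [← pochInf_mul_pow hq hx, zpow_natCast, mul_comm]
  · rw [← pochInf_div_pow hq0 hq, zpow_neg, zpow_natCast, inv_mul_eq_div]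

lemma poch_mul_pochInf (hq0 : q ≠ 0) (hq : ‖q‖ < 1) (hx0 : x ≠ 0)
    (hx : ∀ k : ℕ, x ≠ q ^ (k + 1)) (n : ℤ) :
    poch q x n * pochInf q (q / x) = (-x) ^ n * q ^ tri n * pochInf q (q ^ (1 - n) / x) := by
  have hstep (n : ℤ) : (-x) ^ (n + 1) * q ^ tri (n + 1) * pochInf q (q ^ (1 - (n + 1)) / x) =
      (-x) ^ n * q ^ tri n * pochInf q (q ^ (1 - n) / x) * (1 - x * q ^ n) := by
    have hqn : q ^ n ≠ 0 := zpow_ne_zero n hq0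
    simp only [div_eq_mul_inv _ x]
    rw [show 1 - (n + 1) = -n by ring, pochInf_zpow hq0 hq, neg_add_eq_sub, tri_add_one,
      zpow_add₀ hq0, zpow_add_one₀ (neg_ne_zero.2 hx0), zpow_neg]
    field_simp
    ring
  induction n with
  | zero => simp
  | succ n ih => rw [poch_add_one hq0 hx, hstep, ← ih]; ring
  | pred n ih =>
    have hpoch := poch_add_one hq0 hx (-(n : ℤ) - 1)
    have hright := hstep (-(n : ℤ) - 1)
    rw [sub_add_cancel] at hpoch hright
    rw [hpoch, hright] at ih
    have hne : 1 - x * q ^ (-(n : ℤ) - 1) ≠ 0 := by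
      rw [show -(n : ℤ) - 1 = -((n + 1 : ℕ) : ℤ) by push_cast; ring, zpow_neg, zpow_natCast]
      exact one_sub_div_pow_ne_zero hq0 (hx n)
    refine mul_right_cancel₀ hne ?_
    rw [← ih]
    ring

lemma poch_mul_self_div (hq0 : q ≠ 0) (hx : ∀ k : ℤ, x ≠ q ^ k) (n : ℤ) :
    poch q (x * q) n / poch q x n = (1 - x * q ^ n) / (1 - x) := by
  have hxq (k : ℤ) : x * q ≠ q ^ k := fun h => hx (k - 1) (by
    rw [zpow_sub_one₀ hq0, ← h, mul_inv_cancel_right₀ hq0])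
  have hpoch (n : ℤ) := poch_add_one hq0 (x := x) (fun k => by exact_mod_cast hx (k + 1 : ℕ)) n
  have hpoch_mul (n : ℤ) :=
    poch_add_one hq0 (x := x * q) (fun k => by exact_mod_cast hxq (k + 1 : ℕ)) n
  rw [div_eq_div_iff (poch_ne_zero hx n) (by simpa using one_sub_mul_zpow_ne_zero hx 0)]
  induction n with
  | zero => simp
  | succ n ih =>
    rw [hpoch, hpoch_mul, zpow_add_one₀ hq0]
    linear_combination (1 - x * q * q ^ (n : ℤ)) * ih
  | pred n ih =>
    have h := hpoch (-(n : ℤ) - 1)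
    have h_mul := hpoch_mul (-(n : ℤ) - 1)
    have hpow : q ^ (-(n : ℤ)) = q ^ (-(n : ℤ) - 1) * q := by
      rw [← zpow_add_one₀ hq0, sub_add_cancel]
    rw [sub_add_cancel] at h h_mul
    rw [h, h_mul, hpow] at ih
    refine mul_right_cancel₀ (one_sub_mul_zpow_ne_zero hxq (-(n : ℤ) - 1)) ?_
    linear_combination ih

lemma poch_div_poch (hq0 : q ≠ 0) (hq : ‖q‖ < 1) {a : ℂ} (hx0 : x ≠ 0)
    (hx : ∀ k : ℕ, x ≠ q ^ (k + 1)) (hax : pochInf q (a * q / x) ≠ 0) (n : ℤ) :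
    poch q x n / poch q (a * q / x) n =
      (-x) ^ n * q ^ tri n * (wpFactor q a (1 / x) n / wpFactor q a (1 / x) 0) := by
  have hupper := poch_mul_pochInf hq0 hq hx0 hx n
  have hlower := pochInf_zpow_mul hq0 hq hax n
  have hfactor (n : ℤ) : wpFactor q a (1 / x) n =
      pochInf q (q ^ (1 - n) / x) * pochInf q (q ^ n * (a * q / x)) := by
    rw [wpFactor, mul_one_div, show q ^ (1 + n) * (a * (1 / x)) = q ^ n * (a * q / x) by
      rw [zpow_add₀ hq0, zpow_one]
      ring]
  have hfactor_zero : wpFactor q a (1 / x) 0 = pochInf q (q / x) * pochInf q (a * q / x) := by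
    rw [hfactor, sub_zero, zpow_one, zpow_zero, one_mul]
  rw [hfactor_zero, hfactor, hlower, div_eq_mul_inv, ← mul_div_assoc,
    eq_div_iff (mul_ne_zero (pochInf_q_div_ne_zero hq hx0 hx) hax)]
  linear_combination (poch q (a * q / x) n)⁻¹ * pochInf q (a * q / x) * hupper

end IntegerPochhammer

section EightPsi

variable {q d e : ℂ}

/-- The part of the very-well-poised `₈ψ₈` series with `a = d e` contributed by the parameters
`q √a`, `-q √a`, `d` and `e`, up to the constant `(1 - d) (1 - e) / (1 - d e)`. -/
noncomputable def vwpFactor (q d e : ℂ) (n : ℤ) : ℂ :=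
  (1 - d * e * q ^ (2 * n)) / ((1 - d * q ^ n) * (1 - e * q ^ n))

/-- The `n`-th term of the very-well-poised `₈ψ₈` series with `a = d e` and with parameters `d`,
`e` and `1 / y_i`, normalized so that it is entire in the `y_i`. -/
noncomputable def eightPsiTerm (q d e y₁ y₂ y₃ y₄ : ℂ) (n : ℤ) : ℂ :=
  vwpFactor q d e n * wpQuad q (d * e) y₁ y₂ y₃ y₄ n

/-- The normalized very-well-poised `₈ψ₈` series with `a = d e` and with parameters `d`, `e` and
`1 / y_i`. -/
noncomputable def eightPsi (q d e y₁ y₂ y₃ y₄ : ℂ) : ℂ :=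
  ∑' n : ℤ, eightPsiTerm q d e y₁ y₂ y₃ y₄ n

/-- The `k`-fold shift `(y₁, y₂) ↦ (y₁ / q, q y₂)` of the normalized `₈ψ₈` series, with the factors
that make consecutive shifts differ by a multiple of a `₆ψ₆` series. -/
noncomputable def eightPsiShift (q d e y₁ y₂ y₃ y₄ : ℂ) (k : ℕ) : ℂ :=
  poch q (d * y₁) (1 - k) * poch q (e * y₁) (1 - k) *
    (poch q (d * q * y₂) k * poch q (e * q * y₂) k) *
    eightPsi q d e (y₁ / q ^ k) (y₂ * q ^ k) y₃ y₄

lemma exists_norm_inv_one_sub_mul_zpow_le (hq0 : q ≠ 0) (hq : ‖q‖ < 1) (hd : d ≠ 0) :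
    ∃ C, 0 < C ∧ ∀ n : ℤ, ‖(1 - d * q ^ n)⁻¹‖ ≤ C := by
  have hpow := tendsto_pow_atTop_nhds_zero_of_norm_lt_one hq
  have hpos : Tendsto (fun n : ℕ => (1 - d * q ^ n)⁻¹) atTop (𝓝 (1 - d * 0)⁻¹) :=
    ((hpow.const_mul d).const_sub 1).inv₀ (by simp)
  have hneg : Tendsto (fun n : ℕ => q ^ n * (q ^ n - d)⁻¹) atTop (𝓝 (0 * (0 - d)⁻¹)) :=
    hpow.mul ((hpow.sub_const d).inv₀ (by simpa using hd))
  obtain ⟨C, hC⟩ := (Metric.isBounded_range_of_tendsto _ hpos).exists_norm_le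
  obtain ⟨D, hD⟩ := (Metric.isBounded_range_of_tendsto _ hneg).exists_norm_le
  refine ⟨max 1 (max C D), by positivity, fun n => le_max_of_le_right ?_⟩
  obtain ⟨m, rfl | rfl⟩ := Int.eq_nat_or_neg n
  · rw [zpow_natCast]
    exact le_max_of_le_left (hC _ ⟨m, rfl⟩)
  · have hm : q ^ m ≠ 0 := pow_ne_zero m hq0
    rw [zpow_neg, zpow_natCast,
      show 1 - d * (q ^ m)⁻¹ = (q ^ m)⁻¹ * (q ^ m - d) by field_simp, mul_inv, inv_inv]
    exact le_max_of_le_right (hD _ ⟨m, rfl⟩)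

lemma vwpFactor_eq (hq0 : q ≠ 0) (hd : ∀ k : ℤ, d ≠ q ^ k) (he : ∀ k : ℤ, e ≠ q ^ k) (n : ℤ) :
    vwpFactor q d e n = (1 - d * q ^ n)⁻¹ + (1 - e * q ^ n)⁻¹ - 1 := by
  have hdn := one_sub_mul_zpow_ne_zero hd n
  have hen := one_sub_mul_zpow_ne_zero he n
  rw [vwpFactor, two_mul, zpow_add₀ hq0]
  field_simp
  ring

lemma exists_norm_vwpFactor_le (hq0 : q ≠ 0) (hq : ‖q‖ < 1) (hd0 : d ≠ 0) (he0 : e ≠ 0)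
    (hd : ∀ k : ℤ, d ≠ q ^ k) (he : ∀ k : ℤ, e ≠ q ^ k) :
    ∃ C, 0 < C ∧ ∀ n : ℤ, ‖vwpFactor q d e n‖ ≤ C := by
  obtain ⟨C, hC, hdC⟩ := exists_norm_inv_one_sub_mul_zpow_le hq0 hq hd0
  obtain ⟨D, hD, heD⟩ := exists_norm_inv_one_sub_mul_zpow_le hq0 hq he0
  refine ⟨C + D + 1, by positivity, fun n => ?_⟩
  rw [vwpFactor_eq hq0 hd he]
  refine (norm_sub_le _ _).trans ?_
  rw [norm_one]
  gcongr
  exact norm_add_le_of_le (hdC n) (heD n)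

lemma summable_eightPsiTerm (hq0 : q ≠ 0) (hq : ‖q‖ < 1) (hd0 : d ≠ 0) (he0 : e ≠ 0)
    (hd : ∀ k : ℤ, d ≠ q ^ k) (he : ∀ k : ℤ, e ≠ q ^ k) {y₁ y₂ y₃ y₄ : ℂ}
    (h : ‖(d * e) ^ 2 * q ^ 2 * (y₁ * y₂ * y₃ * y₄)‖ < 1) :
    Summable (eightPsiTerm q d e y₁ y₂ y₃ y₄) := by
  obtain ⟨C, -, hle⟩ := exists_norm_vwpFactor_le hq0 hq hd0 he0 hd he
  refine ((summable_wpQuad hq0 hq (mul_ne_zero hd0 he0) h).norm.mul_left C).of_norm_bounded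
    fun n => ?_
  rw [eightPsiTerm, norm_mul]
  gcongr
  exact hle n

lemma eightPsiTerm_contiguous (hq0 : q ≠ 0) (hq : ‖q‖ < 1) (hd : ∀ k : ℤ, d ≠ q ^ k)
    (he : ∀ k : ℤ, e ≠ q ^ k) (y₁ y₂ y₃ y₄ : ℂ) (n : ℤ) :
    (1 - d * y₁) * (1 - e * y₁) * eightPsiTerm q d e y₁ y₂ y₃ y₄ n -
      (1 - d * (q * y₂)) * (1 - e * (q * y₂)) * eightPsiTerm q d e (y₁ / q) (q * y₂) y₃ y₄ n =
    (y₁ - q * y₂) * (1 - d * e * q * (y₁ * y₂)) *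
      sixPsiTerm q (d * e) y₁ (q * y₂) y₃ y₄ n := by
  have hdn := one_sub_mul_zpow_ne_zero hd n
  have hen := one_sub_mul_zpow_ne_zero he n
  have hx : q ^ n ≠ 0 := zpow_ne_zero n hq0
  have hfactor := wpFactor_eq_mul hq0 hq (d * e) (y₁ / q) n
  rw [mul_div_cancel₀ _ hq0] at hfactor
  simp only [eightPsiTerm, vwpFactor, sixPsiTerm, wpQuad, wpPair]
  rw [hfactor, wpFactor_eq_mul hq0 hq _ y₂, zpow_sub₀ hq0, zpow_add₀ hq0, zpow_neg, two_mul,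
    zpow_add₀ hq0 n n, zpow_one]
  generalize wpFactor q (d * e) y₁ n = P₁
  generalize wpFactor q (d * e) (q * y₂) n = P₂
  generalize (d * e) ^ n * q ^ (n ^ 2) = w
  generalize q ^ n = x at *
  field_simp
  ring

lemma eightPsi_contiguous (hq0 : q ≠ 0) (hq : ‖q‖ < 1) (hd0 : d ≠ 0) (he0 : e ≠ 0)
    (hd : ∀ k : ℤ, d ≠ q ^ k) (he : ∀ k : ℤ, e ≠ q ^ k) {y₁ y₂ y₃ y₄ : ℂ}
    (h : ‖(d * e) ^ 2 * q ^ 2 * (y₁ * y₂ * y₃ * y₄)‖ < 1) :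
    (1 - d * y₁) * (1 - e * y₁) * eightPsi q d e y₁ y₂ y₃ y₄ -
      (1 - d * (q * y₂)) * (1 - e * (q * y₂)) * eightPsi q d e (y₁ / q) (q * y₂) y₃ y₄ =
      (y₁ - q * y₂) * (1 - d * e * q * (y₁ * y₂)) *
        sixPsi q (d * e) y₁ (q * y₂) y₃ y₄ := by
  have h' : ‖(d * e) ^ 2 * q ^ 2 * (y₁ / q * (q * y₂) * y₃ * y₄)‖ < 1 := by
    rwa [show y₁ / q * (q * y₂) = y₁ * y₂ by field_simp]
  simp only [sixPsi, eightPsi, ← tsum_mul_left, ← eightPsiTerm_contiguous hq0 hq hd he]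
  exact (((summable_eightPsiTerm hq0 hq hd0 he0 hd he h).mul_left _).tsum_sub
    ((summable_eightPsiTerm hq0 hq hd0 he0 hd he h').mul_left _)).symm

lemma eightPsiShift_zero (q d e y₁ y₂ y₃ y₄ : ℂ) :
    eightPsiShift q d e y₁ y₂ y₃ y₄ 0 =
      (1 - d * y₁) * (1 - e * y₁) * eightPsi q d e y₁ y₂ y₃ y₄ := by
  have hone (x : ℂ) : poch q x 1 = 1 - x := by simpa using poch_natCast_succ q x 0
  simp [eightPsiShift, hone]

lemma eightPsiShift_sub_succ (hq0 : q ≠ 0) (hq : ‖q‖ < 1) (hd0 : d ≠ 0) (he0 : e ≠ 0)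
    (hd : ∀ k : ℤ, d ≠ q ^ k) (he : ∀ k : ℤ, e ≠ q ^ k) {y₁ y₂ y₃ y₄ : ℂ}
    (hdy : ∀ k : ℕ, d * y₁ ≠ q ^ (k + 1)) (hey : ∀ k : ℕ, e * y₁ ≠ q ^ (k + 1))
    (h : ‖(d * e) ^ 2 * q ^ 2 * (y₁ * y₂ * y₃ * y₄)‖ < 1) (k : ℕ) :
    eightPsiShift q d e y₁ y₂ y₃ y₄ k - eightPsiShift q d e y₁ y₂ y₃ y₄ (k + 1) =
      (y₁ / q ^ k - y₂ * q ^ (k + 1)) * (1 - d * e * q * (y₁ * y₂)) *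
        sixPsi q (d * e) (y₁ / q ^ k) (y₂ * q ^ (k + 1)) y₃ y₄ *
        (poch q (d * y₁) (-k) * poch q (e * y₁) (-k) *
          (poch q (d * q * y₂) k * poch q (e * q * y₂) k)) := by
  have hk : q ^ k ≠ 0 := pow_ne_zero k hq0
  have hprod : y₁ / q ^ k * (y₂ * q ^ k) = y₁ * y₂ := by field_simp
  have hcontiguous := eightPsi_contiguous (y₁ := y₁ / q ^ k) (y₂ := y₂ * q ^ k) (y₃ := y₃)
    (y₄ := y₄) hq0 hq hd0 he0 hd he (by rwa [hprod])
  rw [hprod, show q * (y₂ * q ^ k) = y₂ * q ^ (k + 1) by ring,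
    show y₁ / q ^ k / q = y₁ / q ^ (k + 1) by rw [pow_succ, div_div]] at hcontiguous
  simp only [eightPsiShift, poch_natCast_succ]
  rw [poch_one_sub hq0 hdy k, poch_one_sub hq0 hey k, zpow_neg, zpow_natCast,
    show (1 : ℤ) - (k + 1 : ℕ) = -k by push_cast; ring]
  linear_combination (poch q (d * y₁) (-k) * poch q (e * y₁) (-k) *
    (poch q (d * q * y₂) k * poch q (e * q * y₂) k)) * hcontiguous

end EightPsi

section ShiftLimit

variable {q a d e : ℂ}

lemma tri_neg (n : ℤ) : tri (-n) = tri n + n := by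
  linarith [two_mul_tri n, two_mul_tri (-n)]

lemma tri_add_add_tri_sub (m n : ℤ) : tri (m + n) + tri (m - n) = m ^ 2 - m + n ^ 2 := by
  linarith [two_mul_tri (m + n), two_mul_tri (m - n)]

lemma wpFactor_div_pow (hq0 : q ≠ 0) (a y : ℂ) (k : ℕ) (n : ℤ) :
    wpFactor q a (y / q ^ k) n =
      pochInf q (q ^ (1 - (k + n)) * y) * pochInf q (q ^ (1 - (k - n)) * (a * y)) := by
  have hleft : q ^ (1 - n) * (y / q ^ k) = q ^ (1 - (k + n)) * y := by
    rw [add_comm, ← sub_sub, zpow_sub₀ hq0 (1 - n), zpow_natCast]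
    ring
  have hright : q ^ (1 + n) * (a * (y / q ^ k)) = q ^ (1 - (k - n)) * (a * y) := by
    rw [show 1 - ((k : ℤ) - n) = 1 + n - k by ring, zpow_sub₀ hq0 (1 + n), zpow_natCast]
    ring
  rw [wpFactor, hleft, hright]

lemma wpFactor_mul_pow (hq0 : q ≠ 0) (a y : ℂ) (k : ℕ) (n : ℤ) :
    wpFactor q a (y * q ^ k) n =
      pochInf q (q ^ (1 + (k - n)) * y) * pochInf q (q ^ (1 + (k + n)) * (a * y)) := by
  have hleft : q ^ (1 - n) * (y * q ^ k) = q ^ (1 + (k - n)) * y := by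
    rw [show 1 + ((k : ℤ) - n) = 1 - n + k by ring, zpow_add₀ hq0 (1 - n), zpow_natCast]
    ring
  have hright : q ^ (1 + n) * (a * (y * q ^ k)) = q ^ (1 + (k + n)) * (a * y) := by
    rw [show 1 + ((k : ℤ) + n) = 1 + n + k by ring, zpow_add₀ hq0 (1 + n), zpow_natCast]
    ring
  rw [wpFactor, hleft, hright]

lemma wpPair_shift (hq0 : q ≠ 0) (a y₁ y₂ : ℂ) (k : ℕ) (n : ℤ) :
    wpPair q a (y₁ / q ^ k) (y₂ * q ^ k) n = a ^ n * q ^ (n ^ 2) *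
      ((pochInf q (q ^ (1 - (k + n)) * y₁) * pochInf q (q ^ (1 + (k + n)) * (a * y₂))) *
      (pochInf q (q ^ (1 - (k - n)) * (a * y₁)) * pochInf q (q ^ (1 + (k - n)) * y₂))) := by
  rw [wpPair, wpFactor_div_pow hq0, wpFactor_mul_pow hq0]
  ring

/-- The weight that renormalizes a `k`-fold shifted pair of well-poised factors cancels the
quasi-periods of the two theta functions in its limit. -/
lemma shift_weight_mul {F : Type*} [Field F] {q a y : F} (hq0 : q ≠ 0) (ha : a ≠ 0) (hy : y ≠ 0)
    (k : ℕ) (n : ℤ) :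
    (a * y ^ 2) ^ (-k : ℤ) * q ^ ((k : ℤ) ^ 2 - k) * (a ^ n * q ^ (n ^ 2)) *
      ((y ^ (k + n) * q ^ (-tri (k + n))) * ((a * y) ^ (k - n) * q ^ (-tri (k - n)))) = 1 := by
  have hq_weight : q ^ ((k : ℤ) ^ 2 - k) * q ^ (n ^ 2) *
      (q ^ (-tri (k + n)) * q ^ (-tri (k - n))) = 1 := by
    rw [← zpow_add₀ hq0, ← zpow_add₀ hq0, ← zpow_add₀ hq0, ← neg_add, tri_add_add_tri_sub,
      add_neg_cancel, zpow_zero]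
  have hay : (a * y ^ 2) ^ (-k : ℤ) * a ^ n * (y ^ (k + n) * (a * y) ^ (k - n)) = 1 := by
    have hne := mul_ne_zero ha (pow_ne_zero 2 hy)
    rw [zpow_neg, mul_assoc, inv_mul_eq_one₀ (zpow_ne_zero _ hne), mul_zpow a y, zpow_sub₀ ha,
      zpow_add₀ hy, zpow_sub₀ hy, mul_zpow, zpow_natCast (y ^ 2)]
    field_simp [zpow_ne_zero n ha, zpow_ne_zero n hy]
    rw [zpow_natCast]
    ring
  linear_combination (a * y ^ 2) ^ (-k : ℤ) * a ^ n * (y ^ (k + n) * (a * y) ^ (k - n)) *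
    hq_weight + hay

lemma pochInf_zpow_mul_pochInf_zpow_one_sub (hq0 : q ≠ 0) (hq : ‖q‖ < 1) {y : ℂ} (hy : y ≠ 0)
    (m : ℤ) :
    pochInf q (q ^ m * (1 / y)) * pochInf q (q ^ (1 - m) * y) =
      (-y) ^ m * q ^ (-tri m) * theta q (1 / y) := by
  have hy' : 1 / y ≠ 0 := one_div_ne_zero hy
  have hshift : q / (q ^ m * (1 / y)) = q ^ (1 - m) * y := by
    rw [zpow_sub₀ hq0, zpow_one]
    field_simp
  have hsign : (-(1 / y)) ^ (-m) = (-y) ^ m := by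
    rw [zpow_neg, ← inv_zpow, inv_neg, one_div, inv_inv]
  rw [← hshift, ← theta_eq hq0 hq (mul_ne_zero (zpow_ne_zero m hq0) hy'),
    theta_zpow_mul hq0 hq hy', hsign]

lemma tendsto_pochInf_zpow_add_mul (hq0 : q ≠ 0) (hq : ‖q‖ < 1) (y : ℂ) (n : ℤ) :
    Tendsto (fun k : ℕ => pochInf q (q ^ (k + n) * y)) atTop (𝓝 1) := by
  refine tendsto_pochInf_one hq ?_
  simp only [zpow_add₀ hq0, zpow_natCast, mul_assoc]
  simpa using (tendsto_pow_atTop_nhds_zero_of_norm_lt_one hq).mul_const (q ^ n * y)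

lemma tendsto_inv_mul_pochInf_zpow_one_sub (hq0 : q ≠ 0) (hq : ‖q‖ < 1) {y : ℂ} (hy : y ≠ 0)
    (n : ℤ) :
    Tendsto (fun k : ℕ => ((-y) ^ (k + n) * q ^ (-tri (k + n)))⁻¹ *
      pochInf q (q ^ (1 - (k + n)) * y)) atTop (𝓝 (theta q (1 / y))) := by
  have hone := tendsto_pochInf_zpow_add_mul hq0 hq (1 / y) n
  have hlim := (hone.inv₀ one_ne_zero).const_mul (theta q (1 / y))
  rw [inv_one, mul_one] at hlim
  refine hlim.congr' ?_
  filter_upwards [hone.eventually_ne one_ne_zero] with k hk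
  have hcoeff : (-y) ^ (k + n) * q ^ (-tri (k + n)) ≠ 0 :=
    mul_ne_zero (zpow_ne_zero _ (neg_ne_zero.2 hy)) (zpow_ne_zero _ hq0)
  rw [← div_eq_mul_inv, div_eq_iff hk, mul_assoc, mul_comm (pochInf q (q ^ (1 - _) * y)),
    pochInf_zpow_mul_pochInf_zpow_one_sub hq0 hq hy, inv_mul_cancel_left₀ hcoeff]

lemma tendsto_wpPair_shift (hq0 : q ≠ 0) (hq : ‖q‖ < 1) (ha : a ≠ 0) {y₁ : ℂ} (hy₁ : y₁ ≠ 0)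
    (y₂ : ℂ) (n : ℤ) :
    Tendsto (fun k : ℕ => (a * y₁ ^ 2) ^ (-k : ℤ) * q ^ ((k : ℤ) ^ 2 - k) *
      wpPair q a (y₁ / q ^ k) (y₂ * q ^ k) n) atTop
      (𝓝 (theta q (1 / y₁) * theta q (1 / (a * y₁)))) := by
  have hleft := tendsto_inv_mul_pochInf_zpow_one_sub hq0 hq hy₁ n
  have hright := tendsto_inv_mul_pochInf_zpow_one_sub hq0 hq (mul_ne_zero ha hy₁) (-n)
  have hone := (tendsto_pochInf_zpow_add_mul hq0 hq y₂ (1 - n)).mul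
    (tendsto_pochInf_zpow_add_mul hq0 hq (a * y₂) (1 + n))
  have hlim := (hleft.mul hright).mul hone
  rw [mul_one, mul_one] at hlim
  refine hlim.congr fun k => ?_
  have hweight := shift_weight_mul hq0 ha (neg_ne_zero.2 hy₁) k n
  rw [neg_sq, mul_neg] at hweight
  set A := (-y₁) ^ (k + n) * q ^ (-tri (k + n))
  set B := (-(a * y₁)) ^ (k - n) * q ^ (-tri (k - n)) with hB
  rw [wpPair_shift hq0, ← mul_assoc (_ * _) (a ^ n * _),
    eq_inv_of_mul_eq_one_left hweight, mul_inv, ← sub_eq_add_neg, ← hB,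
    show (k : ℤ) + (1 - n) = 1 + (k - n) by ring, show (k : ℤ) + (1 + n) = 1 + (k + n) by ring]
  ring

lemma exists_norm_pochInf_zpow_mul_pochInf_zpow_le (hq0 : q ≠ 0) (hq : ‖q‖ < 1) {u v : ℂ}
    (hu : u ≠ 0) (hv : v ≠ 0) :
    ∃ C > 0, ∀ m : ℤ, ‖pochInf q (q ^ (1 - m) * u) * pochInf q (q ^ (1 + m) * v)‖ ≤
      C * (‖u‖ ^ m * ‖q‖ ^ (-tri m) * max 1 ‖q * u * v‖ ^ (-m).toNat) := by
  have hq_pos : 0 < ‖q‖ := norm_pos_iff.2 hq0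
  have hu_pos : 0 < ‖u‖ := norm_pos_iff.2 hu
  have hv_pos : 0 < ‖v‖ := norm_pos_iff.2 hv
  obtain ⟨C, hC, hnonneg⟩ := exists_norm_pochInf_mul_pochInf_le hq0 hq hu_pos ‖v‖
  obtain ⟨D, hD, hneg⟩ := exists_norm_pochInf_mul_pochInf_le hq0 hq hv_pos ‖u‖
  refine ⟨C + D, by positivity, fun m => ?_⟩
  obtain ⟨m, rfl | rfl⟩ := Int.eq_nat_or_neg m
  · rw [Int.toNat_neg_natCast, pow_zero, mul_one, zpow_natCast]
    refine (hnonneg u v le_rfl le_rfl m).trans ?_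
    gcongr
    linarith
  · have hreflect : ‖v‖ ^ m * ‖q‖ ^ (-tri m) =
        ‖u‖ ^ (-m : ℤ) * ‖q‖ ^ (-tri (-m)) * ‖q * u * v‖ ^ m := by
      rw [tri_neg, neg_add, zpow_add₀ hq_pos.ne', norm_mul, norm_mul, mul_pow, mul_pow, zpow_neg,
        zpow_neg _ (m : ℤ), zpow_neg _ (m : ℤ), zpow_natCast, zpow_natCast]
      field_simp
    rw [sub_neg_eq_add, ← sub_eq_add_neg, mul_comm (pochInf q _), neg_neg, Int.toNat_natCast]
    refine (hneg v u le_rfl le_rfl m).trans ?_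
    rw [hreflect]
    gcongr
    · linarith
    · exact le_max_right _ _

lemma exists_norm_wpPair_shift_le (hq0 : q ≠ 0) (hq : ‖q‖ < 1) (ha : a ≠ 0) {y₁ y₂ : ℂ}
    (hy₁ : y₁ ≠ 0) (hy₂ : y₂ ≠ 0) :
    ∃ C > 0, ∀ (k : ℕ) (n : ℤ), ‖(a * y₁ ^ 2) ^ (-k : ℤ) * q ^ ((k : ℤ) ^ 2 - k) *
      wpPair q a (y₁ / q ^ k) (y₂ * q ^ k) n‖ ≤ C * max 1 ‖a * q * (y₁ * y₂)‖ ^ n.natAbs := by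
  obtain ⟨C, hC, hleft⟩ :=
    exists_norm_pochInf_zpow_mul_pochInf_zpow_le hq0 hq hy₁ (mul_ne_zero ha hy₂)
  obtain ⟨D, hD, hright⟩ :=
    exists_norm_pochInf_zpow_mul_pochInf_zpow_le hq0 hq (mul_ne_zero ha hy₁) hy₂
  refine ⟨C * D, by positivity, fun k n => ?_⟩
  rw [show q * y₁ * (a * y₂) = a * q * (y₁ * y₂) by ring] at hleft
  rw [show q * (a * y₁) * y₂ = a * q * (y₁ * y₂) by ring] at hright
  have hweight := shift_weight_mul (norm_ne_zero_iff.2 hq0) (norm_ne_zero_iff.2 ha)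
    (norm_ne_zero_iff.2 hy₁) k n
  set t := max 1 ‖a * q * (y₁ * y₂)‖
  have hpow : t ^ (-(k + n : ℤ)).toNat * t ^ (-(k - n : ℤ)).toNat ≤ t ^ n.natAbs := by
    rw [← pow_add]
    exact pow_le_pow_right₀ (le_max_left _ _) (by omega)
  rw [wpPair_shift hq0, ← mul_assoc (_ * _) (_ * _)]
  simp only [norm_mul, norm_zpow, norm_pow] at hleft hright ⊢
  refine (mul_le_mul_of_nonneg_left (mul_le_mul (hleft (k + n)) (hright (k - n)) (by positivity)
    (by positivity)) (by positivity)).trans ?_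
  calc _ = C * D * ((‖a‖ * ‖y₁‖ ^ 2) ^ (-k : ℤ) * ‖q‖ ^ ((k : ℤ) ^ 2 - k) *
        (‖a‖ ^ n * ‖q‖ ^ (n ^ 2)) * ((‖y₁‖ ^ (k + n : ℤ) * ‖q‖ ^ (-tri (k + n))) *
        ((‖a‖ * ‖y₁‖) ^ (k - n : ℤ) * ‖q‖ ^ (-tri (k - n))))) *
        (t ^ (-(k + n : ℤ)).toNat * t ^ (-(k - n : ℤ)).toNat) := by ring
    _ ≤ _ := by
      rw [hweight, mul_one]
      gcongr

lemma wpPair_one_div_mul_one_sub (hq0 : q ≠ 0) (hq : ‖q‖ < 1) (hd0 : d ≠ 0) (he0 : e ≠ 0)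
    (n : ℤ) :
    wpPair q (d * e) (1 / d) (1 / e) n * ((1 - d * q ^ n) * (1 - e * q ^ n)) =
      q ^ n * (theta q d * theta q e) := by
  have hreflect {x : ℂ} (hx : x ≠ 0) : pochInf q (q ^ (1 - n) * (1 / x)) *
      ((1 - x * q ^ n) * pochInf q (q ^ (1 + n) * x)) =
        (-(1 / x)) ^ n * q ^ (-tri n) * theta q x := by
    have h := pochInf_zpow_mul_pochInf_zpow_one_sub hq0 hq (one_div_ne_zero hx) n
    rw [one_div_one_div, pochInf_zpow hq0 hq, mul_comm (q ^ n), add_comm n] at h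
    rw [← h, mul_comm]
  have hq_weight : q ^ (n ^ 2) * (q ^ (-tri n) * q ^ (-tri n)) = q ^ n := by
    rw [← zpow_add₀ hq0, ← zpow_add₀ hq0]
    congr 1
    linarith [two_mul_tri n]
  have hweight : (d * e) ^ n * ((-(1 / d)) ^ n * (-(1 / e)) ^ n) = 1 := by
    rw [← mul_zpow, ← mul_zpow, neg_mul_neg, mul_mul_mul_comm, mul_one_div_cancel hd0,
      mul_one_div_cancel he0, one_mul, one_zpow]
  have hd_cancel : d * e * (1 / d) = e := by field_simp
  have he_cancel : d * e * (1 / e) = d := by field_simp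
  calc _ = (d * e) ^ n * q ^ (n ^ 2) *
        ((pochInf q (q ^ (1 - n) * (1 / d)) * ((1 - d * q ^ n) * pochInf q (q ^ (1 + n) * d))) *
        (pochInf q (q ^ (1 - n) * (1 / e)) * ((1 - e * q ^ n) * pochInf q (q ^ (1 + n) * e)))) := by
        rw [wpPair, wpFactor, wpFactor, hd_cancel, he_cancel]
        ring
    _ = ((d * e) ^ n * ((-(1 / d)) ^ n * (-(1 / e)) ^ n)) *
        (q ^ (n ^ 2) * (q ^ (-tri n) * q ^ (-tri n))) * (theta q d * theta q e) := by
        rw [hreflect hd0, hreflect he0]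
        ring
    _ = _ := by rw [hweight, hq_weight, one_mul]

lemma sixPsiTerm_one_div (hq0 : q ≠ 0) (hq : ‖q‖ < 1) (hd0 : d ≠ 0) (he0 : e ≠ 0)
    (hd : ∀ k : ℤ, d ≠ q ^ k) (he : ∀ k : ℤ, e ≠ q ^ k) (y₃ y₄ : ℂ) (n : ℤ) :
    sixPsiTerm q (d * e) (1 / d) (1 / e) y₃ y₄ n =
      theta q d * theta q e * (vwpFactor q d e n * wpPair q (d * e) y₃ y₄ n) := by
  have hdn := one_sub_mul_zpow_ne_zero hd n
  have hen := one_sub_mul_zpow_ne_zero he n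
  have hqn : q ^ n ≠ 0 := zpow_ne_zero n hq0
  rw [sixPsiTerm, wpQuad, eq_div_of_mul_eq (mul_ne_zero hdn hen)
    (wpPair_one_div_mul_one_sub hq0 hq hd0 he0 n), vwpFactor, zpow_neg, two_mul, zpow_add₀ hq0]
  field_simp

lemma sixPsi_one_div_div_theta_mul_theta (hq0 : q ≠ 0) (hq : ‖q‖ < 1) (hd0 : d ≠ 0)
    (he0 : e ≠ 0) (hd : ∀ k : ℤ, d ≠ q ^ k) (he : ∀ k : ℤ, e ≠ q ^ k) (y₃ y₄ : ℂ) :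
    sixPsi q (d * e) (1 / d) (1 / e) y₃ y₄ / (theta q d * theta q e) =
      ∑' n : ℤ, vwpFactor q d e n * wpPair q (d * e) y₃ y₄ n := by
  have htheta := mul_ne_zero (theta_ne_zero hq0 hq hd0 hd) (theta_ne_zero hq0 hq he0 he)
  simp only [sixPsi, sixPsiTerm_one_div hq0 hq hd0 he0 hd he, tsum_mul_left]
  rw [mul_div_cancel_left₀ _ htheta]

lemma mul_eightPsi_eq_tsum (q d e w y₁ y₂ y₃ y₄ : ℂ) :
    w * eightPsi q d e y₁ y₂ y₃ y₄ = ∑' n : ℤ, vwpFactor q d e n *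
      (w * wpPair q (d * e) y₁ y₂ n * wpPair q (d * e) y₃ y₄ n) := by
  rw [eightPsi, ← tsum_mul_left]
  refine tsum_congr fun n => ?_
  rw [eightPsiTerm, wpQuad]
  ring

lemma tendsto_eightPsi_shift (hq0 : q ≠ 0) (hq : ‖q‖ < 1) (hd0 : d ≠ 0) (he0 : e ≠ 0)
    (hd : ∀ k : ℤ, d ≠ q ^ k) (he : ∀ k : ℤ, e ≠ q ^ k) {y₁ y₂ y₃ y₄ : ℂ}
    (hy₁ : y₁ ≠ 0) (hy₂ : y₂ ≠ 0) (hy₃ : y₃ ≠ 0) (hy₄ : y₄ ≠ 0)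
    (h : ‖(d * e) ^ 2 * q ^ 2 * (y₁ * y₂ * y₃ * y₄)‖ < 1) (h' : ‖d * e * q * (y₃ * y₄)‖ < 1) :
    Tendsto (fun k : ℕ => (d * e * y₁ ^ 2) ^ (-k : ℤ) * q ^ ((k : ℤ) ^ 2 - k) *
      eightPsi q d e (y₁ / q ^ k) (y₂ * q ^ k) y₃ y₄) atTop
      (𝓝 (theta q (1 / y₁) * theta q (1 / (d * e * y₁)) *
        (sixPsi q (d * e) (1 / d) (1 / e) y₃ y₄ / (theta q d * theta q e)))) := by
  have ha : d * e ≠ 0 := mul_ne_zero hd0 he0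
  obtain ⟨C, hC, hvwp⟩ := exists_norm_vwpFactor_le hq0 hq hd0 he0 hd he
  obtain ⟨D, hD, hshift⟩ := exists_norm_wpPair_shift_le hq0 hq ha hy₁ hy₂
  obtain ⟨E, -, hpair⟩ := exists_norm_wpPair_le hq0 hq ha (norm_pos_iff.2 hy₃)
    (norm_pos_iff.2 hy₄)
  replace hpair := hpair y₃ y₄ le_rfl le_rfl
  simp only [← norm_mul] at hpair
  have hratio : max 1 ‖d * e * q * (y₁ * y₂)‖ * ‖d * e * q * (y₃ * y₄)‖ < 1 := by
    rw [max_mul_of_nonneg _ _ (norm_nonneg _), one_mul, ← norm_mul]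
    refine max_lt h' (lt_of_eq_of_lt (congrArg norm ?_) h)
    ring
  simp only [mul_eightPsi_eq_tsum, sixPsi_one_div_div_theta_mul_theta hq0 hq hd0 he0 hd he,
    ← tsum_mul_left, mul_left_comm (theta q (1 / y₁) * _)]
  refine tendsto_tsum_of_dominated_convergence
    ((summable_pow_natAbs (by positivity) hratio).mul_left (C * (D * E))) (fun n => ?_)
    (Eventually.of_forall fun k n => ?_)
  · exact ((tendsto_wpPair_shift hq0 hq ha hy₁ y₂ n).mul_const _).const_mul _
  · rw [norm_mul, norm_mul _ (wpPair q (d * e) y₃ y₄ n)]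
    refine (mul_le_mul (hvwp n) (mul_le_mul (hshift k n) (hpair n) (norm_nonneg _) (by positivity))
      (by positivity) hC.le).trans_eq ?_
    rw [mul_pow]
    ring

lemma eightPsiShift_mul_pochInf (hq0 : q ≠ 0) (hq : ‖q‖ < 1) (hd0 : d ≠ 0) (he0 : e ≠ 0)
    {y₁ : ℂ} (hy₁ : y₁ ≠ 0) (hdy : ∀ k : ℕ, d * y₁ ≠ q ^ (k + 1))
    (hey : ∀ k : ℕ, e * y₁ ≠ q ^ (k + 1)) (y₂ y₃ y₄ : ℂ) (k : ℕ) :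
    eightPsiShift q d e y₁ y₂ y₃ y₄ k * (pochInf q (q / (d * y₁)) * pochInf q (q / (e * y₁))) =
      d * e * y₁ ^ 2 * (pochInf q (q ^ k / (d * y₁)) * pochInf q (q ^ k / (e * y₁)) *
        (poch q (d * q * y₂) k * poch q (e * q * y₂) k) *
        ((d * e * y₁ ^ 2) ^ (-k : ℤ) * q ^ ((k : ℤ) ^ 2 - k) *
          eightPsi q d e (y₁ / q ^ k) (y₂ * q ^ k) y₃ y₄)) := by
  have hd_reflect := poch_mul_pochInf hq0 hq (mul_ne_zero hd0 hy₁) hdy (1 - k)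
  have he_reflect := poch_mul_pochInf hq0 hq (mul_ne_zero he0 hy₁) hey (1 - k)
  have hq_weight : q ^ tri (1 - k) * q ^ tri (1 - k) = q ^ ((k : ℤ) ^ 2 - k) := by
    rw [← zpow_add₀ hq0]
    congr 1
    linarith [two_mul_tri (1 - k)]
  have hweight : (-(d * y₁)) ^ (1 - k : ℤ) * (-(e * y₁)) ^ (1 - k : ℤ) =
      d * e * y₁ ^ 2 * (d * e * y₁ ^ 2) ^ (-k : ℤ) := by
    rw [← mul_zpow, neg_mul_neg, mul_mul_mul_comm, ← sq, sub_eq_add_neg,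
      zpow_one_add₀ (by positivity)]
  rw [sub_sub_cancel, zpow_natCast] at hd_reflect he_reflect
  calc _ = (poch q (d * y₁) (1 - k) * pochInf q (q / (d * y₁))) *
        (poch q (e * y₁) (1 - k) * pochInf q (q / (e * y₁))) *
        (poch q (d * q * y₂) k * poch q (e * q * y₂) k *
          eightPsi q d e (y₁ / q ^ k) (y₂ * q ^ k) y₃ y₄) := by
        rw [eightPsiShift]
        ring
    _ = ((-(d * y₁)) ^ (1 - k : ℤ) * (-(e * y₁)) ^ (1 - k : ℤ)) *
        (q ^ tri (1 - k) * q ^ tri (1 - k)) *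
        (pochInf q (q ^ k / (d * y₁)) * pochInf q (q ^ k / (e * y₁))) *
        (poch q (d * q * y₂) k * poch q (e * q * y₂) k *
          eightPsi q d e (y₁ / q ^ k) (y₂ * q ^ k) y₃ y₄) := by
        rw [hd_reflect, he_reflect]
        ring
    _ = _ := by
        rw [hweight, hq_weight]
        ring

lemma tendsto_eightPsiShift (hq0 : q ≠ 0) (hq : ‖q‖ < 1) (hd0 : d ≠ 0) (he0 : e ≠ 0)
    (hd : ∀ k : ℤ, d ≠ q ^ k) (he : ∀ k : ℤ, e ≠ q ^ k) {y₁ y₂ y₃ y₄ : ℂ}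
    (hy₁ : y₁ ≠ 0) (hy₂ : y₂ ≠ 0) (hy₃ : y₃ ≠ 0) (hy₄ : y₄ ≠ 0)
    (hdy : ∀ k : ℕ, d * y₁ ≠ q ^ (k + 1)) (hey : ∀ k : ℕ, e * y₁ ≠ q ^ (k + 1))
    (h : ‖(d * e) ^ 2 * q ^ 2 * (y₁ * y₂ * y₃ * y₄)‖ < 1) (h' : ‖d * e * q * (y₃ * y₄)‖ < 1) :
    Tendsto (eightPsiShift q d e y₁ y₂ y₃ y₄) atTop (𝓝 (d * e * y₁ ^ 2 *
      (pochInf q (d * q * y₂) * pochInf q (e * q * y₂) *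
        (theta q (1 / y₁) * theta q (1 / (d * e * y₁)) *
          (sixPsi q (d * e) (1 / d) (1 / e) y₃ y₄ / (theta q d * theta q e)))) /
      (pochInf q (q / (d * y₁)) * pochInf q (q / (e * y₁))))) := by
  have hone (x : ℂ) : Tendsto (fun k : ℕ => pochInf q (q ^ k / x)) atTop (𝓝 1) :=
    tendsto_pochInf_one hq (by
      simpa using (tendsto_pow_atTop_nhds_zero_of_norm_lt_one hq).div_const x)
  have hnum := (((hone (d * y₁)).mul (hone (e * y₁))).mul
    ((tendsto_poch_natCast hq (d * q * y₂)).mul (tendsto_poch_natCast hq (e * q * y₂)))).mul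
    (tendsto_eightPsi_shift hq0 hq hd0 he0 hd he hy₁ hy₂ hy₃ hy₄ h h')
  rw [one_mul, one_mul] at hnum
  refine ((hnum.const_mul _).div_const _).congr fun k => ?_
  rw [← eightPsiShift_mul_pochInf hq0 hq hd0 he0 hy₁ hdy hey, mul_div_cancel_right₀ _
    (mul_ne_zero (pochInf_q_div_ne_zero hq (mul_ne_zero hd0 hy₁) hdy)
      (pochInf_q_div_ne_zero hq (mul_ne_zero he0 hy₁) hey))]

end ShiftLimit

section VeryWellPoised

variable {q a b c d e f g z : ℂ}

lemma vwpPsiTerm_eq_mul_psiTerm (hq0 : q ≠ 0) (ha : a ≠ 0) (haq : ∀ k : ℤ, a ≠ q ^ k)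
    (ps : List ℂ) (z : ℂ) (n : ℤ) :
    vwpPsiTerm a ps q z n =
      (1 - a * q ^ (2 * n)) / (1 - a) * psiTerm ps (ps.map fun u => a * q / u) q z n := by
  obtain ⟨s, hs⟩ : ∃ s : ℂ, s = a ^ (1 / 2 : ℂ) := ⟨_, rfl⟩
  have hss : s * s = a := by
    rw [hs, ← pow_two, one_div]
    exact Complex.cpow_ofNat_inv_pow a 2
  have hs0 : s ≠ 0 := left_ne_zero_of_mul (hss ▸ ha)
  have hne (t : ℂ) (ht : t * t = a) (k : ℤ) : t ≠ q ^ k := fun h =>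
    haq (k + k) (by rw [zpow_add₀ hq0, ← h, ht])
  have hs_div : a * q / (q * s) = s := by
    rw [← hss]
    field_simp
  have hratio : poch q (q * s) n * poch q (-(q * s)) n / (poch q s n * poch q (-s) n) =
      (1 - a * q ^ (2 * n)) / (1 - a) := by
    rw [mul_div_mul_comm, mul_comm q s, neg_mul_eq_neg_mul, poch_mul_self_div hq0 (hne s hss),
      poch_mul_self_div hq0 (hne (-s) (by rw [neg_mul_neg, hss])), div_mul_div_comm, ← hss, two_mul,
      zpow_add₀ hq0]
    ring
  simp only [vwpPsiTerm, vwpUpper, psiTerm, pochProd, List.map_cons, List.prod_cons, ← hs, div_neg,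
    hs_div]
  rw [← hratio, ← mul_assoc, ← mul_assoc, mul_div_mul_comm, mul_assoc]

lemma one_sub_mul_psiTerm (hq0 : q ≠ 0) (hd0 : d ≠ 0) (he0 : e ≠ 0) (hd : ∀ k : ℤ, d ≠ q ^ k)
    (he : ∀ k : ℤ, e ≠ q ^ k) (n : ℤ) :
    (1 - d * e * q ^ (2 * n)) *
      psiTerm [b, c, d, e, f, g] ([b, c, d, e, f, g].map fun u => d * e * q / u) q z n =
      (1 - d) * (1 - e) * vwpFactor q d e n *
        ((poch q b n / poch q (d * e * q / b) n) * (poch q c n / poch q (d * e * q / c) n) *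
        ((poch q f n / poch q (d * e * q / f) n) * (poch q g n / poch q (d * e * q / g) n)) *
          z ^ n) := by
  have hd_div : d * e * q / d = e * q := by field_simp
  have he_div : d * e * q / e = d * q := by field_simp
  have hself {x : ℂ} (hx : ∀ k : ℤ, x ≠ q ^ k) :
      poch q x n / poch q (x * q) n = (1 - x) / (1 - x * q ^ n) := by
    rw [← inv_div, poch_mul_self_div hq0 hx, inv_div]
  calc _ = (1 - d * e * q ^ (2 * n)) *
        ((poch q d n / poch q (d * q) n) * (poch q e n / poch q (e * q) n)) *
        ((poch q b n / poch q (d * e * q / b) n) * (poch q c n / poch q (d * e * q / c) n) *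
        ((poch q f n / poch q (d * e * q / f) n) * (poch q g n / poch q (d * e * q / g) n)) *
          z ^ n) := by
        simp only [psiTerm, pochProd, List.map_cons, List.map_nil, List.prod_cons, List.prod_nil,
          hd_div, he_div]
        ring
    _ = _ := by
        rw [hself hd, hself he, vwpFactor]
        simp only [div_eq_mul_inv, mul_inv]
        ring

lemma wellPoised_weight (hq0 : q ≠ 0) (hz : b * c * f * g * z = a ^ 2 * q ^ 2)
    (n : ℤ) :
    (-b) ^ n * (-c) ^ n * ((-f) ^ n * (-g) ^ n) * z ^ n * (q ^ tri n) ^ 4 =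
      (a ^ n * q ^ (n ^ 2)) * (a ^ n * q ^ (n ^ 2)) := by
  have hbase : -b * -c * (-f * -g) * z = (a * a) * q ^ (2 : ℤ) := by
    rw [zpow_ofNat]
    linear_combination hz
  have hexp : q ^ (2 * n) * q ^ (tri n * (4 : ℕ)) = q ^ (n ^ 2 + n ^ 2) := by
    rw [← zpow_add₀ hq0]
    congr 1
    push_cast
    linarith [two_mul_tri n]
  rw [← mul_zpow, ← mul_zpow, ← mul_zpow, ← mul_zpow, hbase, mul_zpow, mul_zpow, ← zpow_mul,
    ← zpow_natCast, ← zpow_mul, mul_assoc, hexp, zpow_add₀ hq0]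
  ring

lemma vwpPsiTerm_eq (hq0 : q ≠ 0) (hq : ‖q‖ < 1) (hb0 : b ≠ 0) (hc0 : c ≠ 0) (hd0 : d ≠ 0)
    (he0 : e ≠ 0) (hf0 : f ≠ 0) (hg0 : g ≠ 0) (hd : ∀ k : ℤ, d ≠ q ^ k) (he : ∀ k : ℤ, e ≠ q ^ k)
    (ha : ∀ k : ℤ, d * e ≠ q ^ k)
    (hb : ∀ k : ℕ, b ≠ q ^ (k + 1)) (hc : ∀ k : ℕ, c ≠ q ^ (k + 1))
    (hf : ∀ k : ℕ, f ≠ q ^ (k + 1)) (hg : ∀ k : ℕ, g ≠ q ^ (k + 1))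
    (hab : pochInf q (d * e * q / b) ≠ 0) (hac : pochInf q (d * e * q / c) ≠ 0)
    (haf : pochInf q (d * e * q / f) ≠ 0) (hag : pochInf q (d * e * q / g) ≠ 0)
    (hz : b * c * f * g * z = (d * e) ^ 2 * q ^ 2) (n : ℤ) :
    vwpPsiTerm (d * e) [b, c, d, e, f, g] q z n =
      eightPsiTerm q d e (1 / b) (1 / c) (1 / f) (1 / g) n /
        eightPsiTerm q d e (1 / b) (1 / c) (1 / f) (1 / g) 0 := by
  have ha0 : d * e ≠ 0 := mul_ne_zero hd0 he0
  rw [vwpPsiTerm_eq_mul_psiTerm hq0 ha0 ha, div_mul_eq_mul_div,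
    one_sub_mul_psiTerm hq0 hd0 he0 hd he, poch_div_poch hq0 hq hb0 hb hab,
    poch_div_poch hq0 hq hc0 hc hac, poch_div_poch hq0 hq hf0 hf haf,
    poch_div_poch hq0 hq hg0 hg hag]
  calc _ = ((-b) ^ n * (-c) ^ n * ((-f) ^ n * (-g) ^ n) * z ^ n * (q ^ tri n) ^ 4) *
        (vwpFactor q d e n * ((1 - d) * (1 - e) / (1 - d * e)) *
        ((wpFactor q (d * e) (1 / b) n / wpFactor q (d * e) (1 / b) 0) *
        (wpFactor q (d * e) (1 / c) n / wpFactor q (d * e) (1 / c) 0) *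
        ((wpFactor q (d * e) (1 / f) n / wpFactor q (d * e) (1 / f) 0) *
        (wpFactor q (d * e) (1 / g) n / wpFactor q (d * e) (1 / g) 0)))) := by ring
    _ = _ := by
        rw [wellPoised_weight hq0 hz n]
        simp only [eightPsiTerm, wpQuad, wpPair, vwpFactor, mul_zero, zpow_zero, mul_one, one_mul,
          div_eq_mul_inv, mul_inv, inv_inv, ne_eq, OfNat.ofNat_ne_zero, not_false_eq_true, zero_pow]
        ring

end VeryWellPoised

section Assembly

variable {q a b c d e f g : ℂ}

lemma eightPsiTerm_zero (q d e y₁ y₂ y₃ y₄ : ℂ) :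
    eightPsiTerm q d e y₁ y₂ y₃ y₄ 0 = vwpFactor q d e 0 *
      ((pochInf q (q * y₁) * pochInf q (q * (d * e * y₁)) *
        (pochInf q (q * y₂) * pochInf q (q * (d * e * y₂)))) *
      (pochInf q (q * y₃) * pochInf q (q * (d * e * y₃)) *
        (pochInf q (q * y₄) * pochInf q (q * (d * e * y₄))))) := by
  simp [eightPsiTerm, wpQuad, wpPair, wpFactor]

lemma kappa₂_eq (hb : b ≠ 0) (hd : d ≠ 0) (he : e ≠ 0) :
    kappa₂ q b d e =
      -(b ^ 2 / (d * e)) * ((1 - d / b) * (1 - e / b)) / pochInf q q * vwpFactor q d e 0 := by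
  have hsub {x y : ℂ} (hx : x ≠ 0) (hy : y ≠ 0) : 1 - x / y = -(x / y) * (1 - y / x) := by
    field_simp
    ring
  rw [kappa₂, vwpFactor, hsub hb hd, hsub hb he, hsub one_ne_zero (mul_ne_zero hd he),
    hsub one_ne_zero hd, hsub one_ne_zero he]
  simp only [mul_zero, zpow_zero, mul_one, div_eq_mul_inv, mul_inv, inv_neg, inv_inv, one_mul]
  field_simp

/-- The factor that clears the infinite products from the `₆ψ₆` sums by which consecutive shifts
of the `₈ψ₈` series differ. -/
noncomputable def clearingFactor (q a b c f g : ℂ) : ℂ :=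
  b * pochInf q (b * c / (f * g)) /
    (pochInf q q * theta q a * pochInf q (a * q / (b * c)) *
      pochInf q ((b * c) ^ 2 / (a * f * g * q)))

/-- The shifted `₈ψ₈` series scaled so that its consecutive differences are multiples of the terms
of the unilateral series. -/
noncomputable def scaledShift (q b c d e f g : ℂ) (k : ℕ) : ℂ :=
  clearingFactor q (d * e) b c f g *
    eightPsiShift q d e (1 / b) (1 / c) (b * c / (d * e * f * q)) (b * c / (d * e * g * q)) k

lemma sq_mul_sq_mul_prod_eq (hq0 : q ≠ 0) (ha : a ≠ 0) (hb : b ≠ 0) (hc : c ≠ 0) :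
    a ^ 2 * q ^ 2 * (1 / b * (1 / c) * (b * c / (a * f * q)) * (b * c / (a * g * q))) =
      b * c / (f * g) := by
  field_simp

lemma mul_q_mul_mul_eq (hq0 : q ≠ 0) (ha : a ≠ 0) :
    a * q * (b * c / (a * f * q) * (b * c / (a * g * q))) = (b * c) ^ 2 / (a * f * g * q) := by
  field_simp

lemma clearingFactor_mul_sixPsi (hq0 : q ≠ 0) (hq : ‖q‖ < 1) (hb : b ≠ 0) (hc : c ≠ 0)
    (ha0 : a ≠ 0) (ha : ∀ k : ℤ, a ≠ q ^ k) (habc : ∀ k : ℤ, a ≠ b * c * q ^ k)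
    (hconv₁ : ‖b * c / (f * g)‖ < 1) (hconv₂ : ‖(b * c) ^ 2 / (a * f * g * q)‖ < 1) (k : ℕ) :
    clearingFactor q a b c f g * ((1 - a * q * (1 / b * (1 / c))) *
        sixPsi q a (1 / b / q ^ k) (1 / c * q ^ (k + 1)) (b * c / (a * f * q))
          (b * c / (a * g * q))) =
      b * (pochInf q (c / f / q ^ k) * pochInf q (c / g / q ^ k) *
        (pochInf q (b * q / f * q ^ k) * pochInf q (b * q / g * q ^ k))) := by
  have h₁₂ : a * q * (1 / b / q ^ k * (1 / c * q ^ (k + 1))) = a * q / (b * c) * q := by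
    rw [pow_succ]
    field_simp
  have h₁ (x : ℂ) : a * q * (1 / b / q ^ k * (b * c / (a * x * q))) = c / x / q ^ k := by
    field_simp
  have h₂ (x : ℂ) : a * q * (1 / c * q ^ (k + 1) * (b * c / (a * x * q))) = b * q / x * q ^ k := by
    rw [pow_succ]
    field_simp
  have h_all : a ^ 2 * q * (1 / b / q ^ k * (1 / c * q ^ (k + 1)) * (b * c / (a * f * q)) *
      (b * c / (a * g * q))) = b * c / (f * g) := by
    rw [← sq_mul_sq_mul_prod_eq (f := f) (g := g) hq0 ha0 hb hc, pow_succ]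
    field_simp
    ring
  have hshift : (1 - a * q * (1 / b * (1 / c))) * pochInf q (a * q / (b * c) * q) =
      pochInf q (a * q / (b * c)) := by
    rw [pochInf_eq_mul hq (a * q / (b * c)), div_eq_mul_one_div (a * q), one_div_mul_one_div]
  have hq_ne := pochInf_ne_zero_of_norm_lt_one hq hq
  have hfg_ne := pochInf_ne_zero_of_norm_lt_one hq hconv₁
  have hW_ne := pochInf_ne_zero_of_norm_lt_one hq hconv₂
  have htheta_ne := theta_ne_zero hq0 hq ha0 ha
  have habc_ne := pochInf_mul_q_div_ne_zero hq0 hq (mul_ne_zero hb hc) habc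
  rw [sixPsi_eq hq0 hq ha0 (by rwa [h_all]), h_all, h₁₂, h₁, h₁, h₂, h₂,
    mul_q_mul_mul_eq hq0 ha0, clearingFactor, div_mul_eq_mul_div, div_eq_iff (by simp [*])]
  rw [mul_div_assoc', mul_div_assoc', div_eq_iff hfg_ne, ← hshift]
  ring

lemma mul_one_div_ne_pow {x : ℂ} (hb : b ≠ 0) (h : ∀ k : ℕ, b * q ^ (k + 1) ≠ x) (k : ℕ) :
    x * (1 / b) ≠ q ^ (k + 1) := by
  rw [mul_one_div, Ne, div_eq_iff hb, mul_comm, ← Ne, ne_comm]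
  exact h k

lemma pochInf_mul_q_div_ne_zero_of_pow {x : ℂ} (hq : ‖q‖ < 1) (hx : x ≠ 0)
    (h : ∀ k : ℕ, b * q ^ (k + 1) ≠ x) : pochInf q (b * q / x) ≠ 0 :=
  pochInf_div_ne_zero hq hx fun k => by
    rw [mul_assoc, ← pow_succ']
    exact h k

lemma poch_neg_mul_inv_poch_neg {x y : ℂ} (hq0 : q ≠ 0) (hb : b ≠ 0) (hc : c ≠ 0) (hx : x ≠ 0)
    (hy : y ≠ 0) (k : ℕ) :
    poch q (x * (1 / b)) (-k) * (poch q (c / y) (-k))⁻¹ =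
      (b * c / (x * y)) ^ k * (poch q (y * q / c) k / poch q (b * q / x) k) := by
  rw [← div_eq_mul_inv, poch_neg_div_poch_neg hq0 (mul_ne_zero hx (one_div_ne_zero hb))
      (div_ne_zero hc hy),
    show c / y / (x * (1 / b)) = b * c / (x * y) by field_simp,
    show q / (c / y) = y * q / c by field_simp, show q / (x * (1 / b)) = b * q / x by field_simp]

lemma Omega_mul_uniTerm (hq0 : q ≠ 0) (hq : ‖q‖ < 1) (hb : b ≠ 0) (hc : c ≠ 0) (hd : d ≠ 0)
    (he : e ≠ 0) (hf : f ≠ 0) (hg : g ≠ 0) (hbf : ∀ k : ℕ, b * q ^ (k + 1) ≠ f)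
    (hbg : ∀ k : ℕ, b * q ^ (k + 1) ≠ g) (k : ℕ) :
    Omega q [b * q, c] [f, g] * uniTerm q b c d e f g k =
      (1 / b / q ^ k - 1 / c * q ^ (k + 1)) *
        (b * (pochInf q (c / f / q ^ k) * pochInf q (c / g / q ^ k) *
          (pochInf q (b * q / f * q ^ k) * pochInf q (b * q / g * q ^ k)))) *
        (poch q (d * (1 / b)) (-k) * poch q (e * (1 / b)) (-k) *
          (poch q (d * q * (1 / c)) k * poch q (e * q * (1 / c)) k)) := by
  have hprefactor : b * (1 / b / q ^ k - 1 / c * q ^ (k + 1)) =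
      (1 - b * q ^ (2 * k + 1) / c) * (q ^ k)⁻¹ := by
    rw [two_mul, pow_succ, pow_succ, pow_add]
    field_simp
  have hpow : (b * c / (d * f)) ^ k * (b * c / (e * g)) ^ k * (q ^ k)⁻¹ =
      ((b * c) ^ 2 / (d * e * f * g * q)) ^ k := by
    rw [← inv_pow, ← mul_pow, ← mul_pow]
    congr 1
    field_simp
  calc _ = (1 - b * q ^ (2 * k + 1) / c) *
        ((b * c / (d * f)) ^ k * (b * c / (e * g)) ^ k * (q ^ k)⁻¹) *
        (poch q (d * q / c) k * poch q (e * q / c) k * poch q (f * q / c) k * poch q (g * q / c) k /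
          (poch q (b * q / d) k * poch q (b * q / e) k * poch q (b * q / f) k *
            poch q (b * q / g) k)) *
        (pochInf q (b * q / f) * pochInf q (b * q / g) *
          (pochInf q (c / f) * pochInf q (c / g))) := by
        rw [hpow]
        simp only [Omega, uniTerm, pochProd, List.map_cons, List.map_nil, List.prod_cons,
          List.prod_nil, mul_one]
        generalize ((b * c) ^ 2 / (d * e * f * g * q)) ^ k = w
        ring
    _ = b * (1 / b / q ^ k - 1 / c * q ^ (k + 1)) *
        (poch q (d * (1 / b)) (-k) * (poch q (c / f) (-k))⁻¹ *
          (poch q (e * (1 / b)) (-k) * (poch q (c / g) (-k))⁻¹)) *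
        (poch q (d * q / c) k * poch q (e * q / c) k /
          (poch q (b * q / f) k * poch q (b * q / g) k)) *
        (pochInf q (b * q / f) * pochInf q (b * q / g) *
          (pochInf q (c / f) * pochInf q (c / g))) := by
        rw [hprefactor, poch_neg_mul_inv_poch_neg hq0 hb hc hd hf,
          poch_neg_mul_inv_poch_neg hq0 hb hc he hg]
        ring
    _ = _ := by
        rw [pochInf_div_pow hq0 hq, pochInf_div_pow hq0 hq,
          pochInf_mul_pow hq (pochInf_mul_q_div_ne_zero_of_pow hq hf hbf),
          pochInf_mul_pow hq (pochInf_mul_q_div_ne_zero_of_pow hq hg hbg), mul_one_div (d * q),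
          mul_one_div (e * q)]
        ring

lemma scaledShift_sub_succ (hq0 : q ≠ 0) (hq : ‖q‖ < 1) (hb : b ≠ 0) (hc : c ≠ 0) (hd : d ≠ 0)
    (he : e ≠ 0) (hf : f ≠ 0) (hg : g ≠ 0) (hdq : ∀ k : ℤ, d ≠ q ^ k) (heq : ∀ k : ℤ, e ≠ q ^ k)
    (hdeq : ∀ k : ℤ, d * e ≠ q ^ k) (hdebc : ∀ k : ℤ, d * e ≠ b * c * q ^ k)
    (hbd : ∀ k : ℕ, b * q ^ (k + 1) ≠ d) (hbe : ∀ k : ℕ, b * q ^ (k + 1) ≠ e)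
    (hbf : ∀ k : ℕ, b * q ^ (k + 1) ≠ f) (hbg : ∀ k : ℕ, b * q ^ (k + 1) ≠ g)
    (hconv₁ : ‖b * c / (f * g)‖ < 1) (hconv₂ : ‖(b * c) ^ 2 / (d * e * f * g * q)‖ < 1) (k : ℕ) :
    scaledShift q b c d e f g k - scaledShift q b c d e f g (k + 1) =
      Omega q [b * q, c] [f, g] * uniTerm q b c d e f g k := by
  have hde := mul_ne_zero hd he
  have hdiff := eightPsiShift_sub_succ (y₂ := 1 / c) (y₃ := b * c / (d * e * f * q))
    (y₄ := b * c / (d * e * g * q)) hq0 hq hd he hdq heq (mul_one_div_ne_pow hb hbd)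
    (mul_one_div_ne_pow hb hbe) (by rwa [sq_mul_sq_mul_prod_eq hq0 hde hb hc]) k
  rw [scaledShift, scaledShift, ← mul_sub, hdiff,
    Omega_mul_uniTerm hq0 hq hb hc hd he hf hg hbf hbg,
    ← clearingFactor_mul_sixPsi hq0 hq hb hc hde hdeq hdebc hconv₁ hconv₂]
  ring

lemma clearingFactor_mul_sixPsi_one_div (hq0 : q ≠ 0) (hq : ‖q‖ < 1) (hb : b ≠ 0) (hc : c ≠ 0)
    (hd : d ≠ 0) (he : e ≠ 0) (hf : f ≠ 0) (hg : g ≠ 0)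
    (hdeq : ∀ k : ℤ, d * e ≠ q ^ k) (hconv₂ : ‖(b * c) ^ 2 / (d * e * f * g * q)‖ < 1) :
    clearingFactor q (d * e) b c f g *
        sixPsi q (d * e) (1 / d) (1 / e) (b * c / (d * e * f * q)) (b * c / (d * e * g * q)) =
      b * (pochInf q q * Omega q [b * c] [d * f, d * g, e * f, e * g, f * g] /
        (pochInf q (d * e * q / (b * c)) * pochInf q ((b * c) ^ 2 / (d * e * f * g * q)))) := by
  have hde := mul_ne_zero hd he
  have h₁ (x : ℂ) : d * e * q * (1 / d * (b * c / (d * e * x * q))) = b * c / (d * x) := by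
    field_simp
  have h₂ (x : ℂ) : d * e * q * (1 / e * (b * c / (d * e * x * q))) = b * c / (e * x) := by
    field_simp
  have h₁₂ : d * e * q * (1 / d * (1 / e)) = q := by field_simp
  have h_all : (d * e) ^ 2 * q * (1 / d * (1 / e) * (b * c / (d * e * f * q)) *
      (b * c / (d * e * g * q))) = (b * c) ^ 2 / (d * e * f * g * q) := by
    field_simp
  have hq_ne := pochInf_ne_zero_of_norm_lt_one hq hq
  have htheta_ne := theta_ne_zero hq0 hq hde hdeq
  rw [sixPsi_eq hq0 hq hde (by rwa [h_all]), h_all, h₁₂, h₁, h₁, h₂, h₂,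
    mul_q_mul_mul_eq hq0 hde, clearingFactor]
  simp only [Omega, List.map_cons, List.map_nil, List.prod_cons, List.prod_nil, mul_one]
  field_simp

lemma second_term_eq (hq0 : q ≠ 0) (hb : b ≠ 0) (hc : c ≠ 0) (hd : d ≠ 0) (he : e ≠ 0) :
    thetaProd q [1 / b, d * e * q / b] / thetaProd q [1 / d, 1 / e] *
        (Omega q [q / c] [1 / c, 1 / d, 1 / e] *
            Omega q [b * c] [d * f, d * g, e * f, e * g, f * g] /
          Omega q [1 / (d * e)] [1 / (b * d * q), 1 / (b * e * q), b * c / ((d * e) ^ 2 * q),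
            f * g * q / (b * c) ^ 2]) =
      theta q (1 / b) * theta q (d * e * q / b) / (theta q (1 / d) * theta q (1 / e)) *
        (pochInf q (d * q / c) * pochInf q (e * q / c) /
          (pochInf q (b * q / d) * pochInf q (b * q / e))) *
        (pochInf q q * Omega q [b * c] [d * f, d * g, e * f, e * g, f * g] /
          (pochInf q (d * e * q / (b * c)) * pochInf q ((b * c) ^ 2 / (d * e * f * g * q)))) := by
  have hc_arg : q / c / (1 / c) = q := by field_simp
  have hdc_arg (x : ℂ) : q / c / (1 / x) = x * q / c := by field_simp
  have hd_arg : 1 / (d * e) / (1 / (b * e * q)) = b * q / d := by field_simp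
  have he_arg : 1 / (d * e) / (1 / (b * d * q)) = b * q / e := by field_simp
  have hbc_arg : 1 / (d * e) / (b * c / ((d * e) ^ 2 * q)) = d * e * q / (b * c) := by field_simp
  have hW_arg : 1 / (d * e) / (f * g * q / (b * c) ^ 2) = (b * c) ^ 2 / (d * e * f * g * q) := by
    field_simp
  simp only [Omega, thetaProd, List.map_cons, List.map_nil, List.prod_cons, List.prod_nil,
    mul_one, hc_arg, hdc_arg, hd_arg, he_arg, hbc_arg, hW_arg]
  ring

lemma clearingFactor_mul_limit_eq {C s t : ℂ} (hq0 : q ≠ 0) (hq : ‖q‖ < 1) (hb : b ≠ 0)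
    (hd : d ≠ 0) (he : e ≠ 0) (hCs : C * s = b * t) :
    C * (d * e * (1 / b) ^ 2 *
      (pochInf q (d * q * (1 / c)) * pochInf q (e * q * (1 / c)) *
        (theta q (1 / (1 / b)) * theta q (1 / (d * e * (1 / b))) *
          (s / (theta q d * theta q e)))) /
        (pochInf q (q / (d * (1 / b))) * pochInf q (q / (e * (1 / b))))) =
      -(theta q (1 / b) * theta q (d * e * q / b) / (theta q (1 / d) * theta q (1 / e)) *
        (pochInf q (d * q / c) * pochInf q (e * q / c) /
          (pochInf q (b * q / d) * pochInf q (b * q / e))) * t) := by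
  have hdb_arg (x : ℂ) : q / (x * (1 / b)) = b * q / x := by field_simp
  have htheta : theta q (1 / (d * e * (1 / b))) = theta q (d * e * q / b) := by
    rw [← theta_q_div hq0 hq (x := d * e * q / b) (by positivity)]
    congr 1
    field_simp
  rw [hdb_arg, hdb_arg, htheta, one_div_one_div, theta_eq_neg_mul_theta_one_div hq0 hq hb,
    theta_eq_neg_mul_theta_one_div hq0 hq hd, theta_eq_neg_mul_theta_one_div hq0 hq he,
    mul_one_div (d * q), mul_one_div (e * q), eq_div_of_mul_eq hb ((mul_comm _ _).trans hCs.symm)]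
  field_simp

lemma tendsto_scaledShift (hq0 : q ≠ 0) (hq : ‖q‖ < 1) (hb : b ≠ 0) (hc : c ≠ 0) (hd : d ≠ 0)
    (he : e ≠ 0) (hf : f ≠ 0) (hg : g ≠ 0) (hdq : ∀ k : ℤ, d ≠ q ^ k) (heq : ∀ k : ℤ, e ≠ q ^ k)
    (hdeq : ∀ k : ℤ, d * e ≠ q ^ k)
    (hbd : ∀ k : ℕ, b * q ^ (k + 1) ≠ d) (hbe : ∀ k : ℕ, b * q ^ (k + 1) ≠ e)
    (hconv₁ : ‖b * c / (f * g)‖ < 1) (hconv₂ : ‖(b * c) ^ 2 / (d * e * f * g * q)‖ < 1) :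
    Tendsto (scaledShift q b c d e f g) atTop
      (𝓝 (-(thetaProd q [1 / b, d * e * q / b] / thetaProd q [1 / d, 1 / e] *
        (Omega q [q / c] [1 / c, 1 / d, 1 / e] *
            Omega q [b * c] [d * f, d * g, e * f, e * g, f * g] /
          Omega q [1 / (d * e)] [1 / (b * d * q), 1 / (b * e * q), b * c / ((d * e) ^ 2 * q),
            f * g * q / (b * c) ^ 2])))) := by
  have hde := mul_ne_zero hd he
  have hlim := (tendsto_eightPsiShift (y₂ := 1 / c) (y₃ := b * c / (d * e * f * q))
    (y₄ := b * c / (d * e * g * q)) hq0 hq hd he hdq heq (one_div_ne_zero hb) (one_div_ne_zero hc)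
    (by positivity) (by positivity) (mul_one_div_ne_pow hb hbd)
    (mul_one_div_ne_pow hb hbe) (by rwa [sq_mul_sq_mul_prod_eq hq0 hde hb hc])
    (by rwa [mul_q_mul_mul_eq hq0 hde])).const_mul (clearingFactor q (d * e) b c f g)
  rwa [clearingFactor_mul_limit_eq hq0 hq hb hd he
    (clearingFactor_mul_sixPsi_one_div hq0 hq hb hc hd he hf hg hdeq hconv₂),
    ← second_term_eq hq0 hb hc hd he] at hlim

lemma eightPsiTerm_zero_ne_zero (hq : ‖q‖ < 1) (hb : b ≠ 0) (hc : c ≠ 0) (hf : f ≠ 0)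
    (hg : g ≠ 0) (hdq : ∀ k : ℤ, d ≠ q ^ k) (heq : ∀ k : ℤ, e ≠ q ^ k)
    (hdeq : ∀ k : ℤ, d * e ≠ q ^ k) (hbq : ∀ k : ℕ, b ≠ q ^ (k + 1))
    (hcq : ∀ k : ℕ, c ≠ q ^ (k + 1)) (hfq : ∀ k : ℕ, f ≠ q ^ (k + 1))
    (hgq : ∀ k : ℕ, g ≠ q ^ (k + 1)) (hab : pochInf q (d * e * q / b) ≠ 0)
    (hac : pochInf q (d * e * q / c) ≠ 0) (haf : pochInf q (d * e * q / f) ≠ 0)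
    (hag : pochInf q (d * e * q / g) ≠ 0) :
    eightPsiTerm q d e (1 / b) (1 / c) (1 / f) (1 / g) 0 ≠ 0 := by
  have hvwp : vwpFactor q d e 0 ≠ 0 :=
    div_ne_zero (by simpa using one_sub_mul_zpow_ne_zero hdeq 0)
      (mul_ne_zero (one_sub_mul_zpow_ne_zero hdq 0) (one_sub_mul_zpow_ne_zero heq 0))
  have hne {x : ℂ} := pochInf_q_div_ne_zero hq (x := x)
  have harg (x : ℂ) : q * (d * e * (1 / x)) = d * e * q / x := by ring
  rw [eightPsiTerm_zero]
  simp only [mul_one_div q, harg]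
  exact mul_ne_zero hvwp (mul_ne_zero
    (mul_ne_zero (mul_ne_zero (hne hb hbq) hab) (mul_ne_zero (hne hc hcq) hac))
    (mul_ne_zero (mul_ne_zero (hne hf hfq) haf) (mul_ne_zero (hne hg hgq) hag)))

lemma first_term_coefficient_eq (hq0 : q ≠ 0) (hq : ‖q‖ < 1) (hb : b ≠ 0) (hc : c ≠ 0)
    (hd : d ≠ 0) (he : e ≠ 0) (hdeb : ∀ k : ℤ, d * e ≠ b * q ^ k)
    (hdec : ∀ k : ℤ, d * e ≠ c * q ^ k) (hdebc : ∀ k : ℤ, d * e ≠ b * c * q ^ k) :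
    kappa₂ q b d e *
        (thetaProd q [d * e * q / c, d * e / b] / thetaProd q [d * e * q / (b * c), d * e]) *
        (Omega q [q] [b, c] * Omega q [b * c] [f, g, d * e, f * g, d * e * f, d * e * g] /
          Omega q [1 / (d * e)] [1 / b, 1 / c, f * g * q / (b * c) ^ 2]) =
      clearingFactor q (d * e) b c f g * ((1 - d * (1 / b)) * (1 - e * (1 / b))) *
        eightPsiTerm q d e (1 / b) (1 / c) (b * c / (d * e * f * q))
          (b * c / (d * e * g * q)) 0 := by
  have hde := mul_ne_zero hd he
  have hbc := mul_ne_zero hb hc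
  have hne {x : ℂ} (h : ∀ k : ℤ, d * e ≠ x * q ^ k) : pochInf q (x / (d * e)) ≠ 0 :=
    pochInf_div_ne_zero hq hde fun k => by exact_mod_cast (h k).symm
  have hdiv_arg (x : ℂ) : 1 / (d * e) / (1 / x) = x / (d * e) := by field_simp
  have hW_arg : 1 / (d * e) / (f * g * q / (b * c) ^ 2) = (b * c) ^ 2 / (d * e * f * g * q) := by
    field_simp
  have hq_arg (x : ℂ) : q * (b * c / (d * e * x * q)) = b * c / (d * e * x) := by field_simp
  have hdeq_arg (x : ℂ) : q * (d * e * (b * c / (d * e * x * q))) = b * c / x := by field_simp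
  have hde_arg (x : ℂ) : q * (d * e / x) = d * e * q / x := by ring
  rw [eightPsiTerm_zero, kappa₂_eq hb hd he, clearingFactor]
  simp only [Omega, thetaProd, List.map_cons, List.map_nil, List.prod_cons, List.prod_nil, mul_one,
    hdiv_arg, hW_arg, hq_arg, hdeq_arg, hde_arg, mul_one_div,
    theta_mul_q_div hq0 hq hde hc, theta_mul_q_div hq0 hq hde hbc, theta_div hq0 hq hde hb]
  have hcancel : b ^ 2 / (d * e) * (d * e / b) *
      (pochInf q (b / (d * e)) / pochInf q (b / (d * e)) *
        (pochInf q (c / (d * e)) / pochInf q (c / (d * e))) *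
        (pochInf q (b * c / (d * e)) / pochInf q (b * c / (d * e)))) = b := by
    rw [div_self (hne hdeb), div_self (hne hdec), div_self (hne hdebc)]
    field_simp
  linear_combination (pochInf q (b * c / (f * g)) * ((1 - d / b) * (1 - e / b)) *
    vwpFactor q d e 0 / (pochInf q q * theta q (d * e) * pochInf q (d * e * q / (b * c)) *
      pochInf q ((b * c) ^ 2 / (d * e * f * g * q))) *
    (pochInf q (q / b) * pochInf q (d * e * q / b) *
      (pochInf q (q / c) * pochInf q (d * e * q / c)) *
      (pochInf q (b * c / (d * e * f)) * pochInf q (b * c / f) *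
        (pochInf q (b * c / (d * e * g)) * pochInf q (b * c / g))))) * hcancel

lemma summable_uniTerm (hq : ‖q‖ < 1) (hd : d ≠ 0) (he : e ≠ 0) (hf : f ≠ 0) (hg : g ≠ 0)
    (hconv₂ : ‖(b * c) ^ 2 / (d * e * f * g * q)‖ < 1)
    (hbd : ∀ k : ℕ, b * q ^ (k + 1) ≠ d) (hbe : ∀ k : ℕ, b * q ^ (k + 1) ≠ e)
    (hbf : ∀ k : ℕ, b * q ^ (k + 1) ≠ f) (hbg : ∀ k : ℕ, b * q ^ (k + 1) ≠ g) :
    Summable (uniTerm q b c d e f g) := by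
  have hpoch := tendsto_poch_natCast hq
  have hne {x : ℂ} := pochInf_mul_q_div_ne_zero_of_pow (b := b) (x := x) hq
  have hprefactor : Tendsto (fun n : ℕ => 1 - b * q ^ (2 * n + 1) / c) atTop
      (𝓝 (1 - b * 0 / c)) :=
    ((((tendsto_pow_atTop_nhds_zero_of_norm_lt_one hq).comp (tendsto_add_atTop_nat 1)).comp
      (tendsto_id.const_mul_atTop' two_pos)).const_mul b |>.div_const c).const_sub 1
  have hcoeff := hprefactor.mul (((hpoch (d * q / c)).mul ((hpoch (e * q / c)).mul
    ((hpoch (f * q / c)).mul (hpoch (g * q / c))))).div ((hpoch (b * q / d)).mul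
    ((hpoch (b * q / e)).mul ((hpoch (b * q / f)).mul (hpoch (b * q / g)))))
    (mul_ne_zero (hne hd hbd) (mul_ne_zero (hne he hbe) (mul_ne_zero (hne hf hbf) (hne hg hbg)))))
  obtain ⟨C, hC⟩ := (Metric.isBounded_range_of_tendsto _ hcoeff).exists_norm_le
  refine ((summable_geometric_of_lt_one (norm_nonneg _) hconv₂).mul_left C).of_norm_bounded
    fun n => ?_
  simp only [uniTerm, pochProd, List.map_cons, List.map_nil, List.prod_cons, List.prod_nil, mul_one]
  rw [norm_mul, norm_pow]
  gcongr
  exact hC _ ⟨n, rfl⟩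

lemma vwpPsiTerm_eq_eightPsiTerm (hq0 : q ≠ 0) (hq : ‖q‖ < 1) (hb : b ≠ 0) (hc : c ≠ 0)
    (hd : d ≠ 0) (he : e ≠ 0) (hf : f ≠ 0) (hg : g ≠ 0)
    (hdq : ∀ k : ℤ, d ≠ q ^ k) (heq : ∀ k : ℤ, e ≠ q ^ k) (hdeq : ∀ k : ℤ, d * e ≠ q ^ k)
    (hdeb : ∀ k : ℤ, d * e ≠ b * q ^ k) (hdec : ∀ k : ℤ, d * e ≠ c * q ^ k)
    (hbq : ∀ k : ℕ, b ≠ q ^ (k + 1)) (hcq : ∀ k : ℕ, c ≠ q ^ (k + 1))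
    (hfbc : ∀ k : ℕ, b * c * q ^ k ≠ f) (hgbc : ∀ k : ℕ, b * c * q ^ k ≠ g)
    (hdef : ∀ k : ℕ, d * e * f ≠ b * c * q ^ k) (hdeg : ∀ k : ℕ, d * e * g ≠ b * c * q ^ k) :
    eightPsiTerm q d e (1 / b) (1 / c) (b * c / (d * e * f * q)) (b * c / (d * e * g * q)) 0 ≠ 0 ∧
    ∀ n : ℤ, vwpPsiTerm (d * e)
      [b, c, d, e, d * e * f * q / (b * c), d * e * g * q / (b * c)] q (b * c / (f * g)) n =
        eightPsiTerm q d e (1 / b) (1 / c) (b * c / (d * e * f * q)) (b * c / (d * e * g * q)) n /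
          eightPsiTerm q d e (1 / b) (1 / c) (b * c / (d * e * f * q))
            (b * c / (d * e * g * q)) 0 := by
  have hbc := mul_ne_zero hb hc
  have hne {x : ℂ} (hx : x ≠ 0) : d * e * x * q / (b * c) ≠ 0 := by positivity
  have hpow {x : ℂ} (h : ∀ k : ℕ, d * e * x ≠ b * c * q ^ k) (k : ℕ) :
      d * e * x * q / (b * c) ≠ q ^ (k + 1) := fun hk => h k <| mul_right_cancel₀ hq0 <| by
    rw [(div_eq_iff hbc).1 hk, pow_succ]
    ring
  have hpoch {x : ℂ} (hx : x ≠ 0) (h : ∀ k : ℕ, b * c * q ^ k ≠ x) :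
      pochInf q (d * e * q / (d * e * x * q / (b * c))) ≠ 0 := by
    rw [show d * e * q / (d * e * x * q / (b * c)) = b * c / x by field_simp]
    exact pochInf_div_ne_zero hq hx h
  have hab := pochInf_mul_q_div_ne_zero hq0 hq hb hdeb
  have hac := pochInf_mul_q_div_ne_zero hq0 hq hc hdec
  rw [← one_div_div (d * e * f * q), ← one_div_div (d * e * g * q)]
  exact ⟨eightPsiTerm_zero_ne_zero hq hb hc (hne hf) (hne hg) hdq heq hdeq hbq hcq (hpow hdef)
    (hpow hdeg) hab hac (hpoch hf hfbc) (hpoch hg hgbc),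
    vwpPsiTerm_eq hq0 hq hb hc hd he (hne hf) (hne hg) hdq heq hdeq hbq hcq (hpow hdef)
    (hpow hdeg) hab hac (hpoch hf hfbc) (hpoch hg hgbc) (by field_simp)⟩

lemma kappa₂_mul_vwpPsi (hq0 : q ≠ 0) (hq : ‖q‖ < 1) (hb : b ≠ 0) (hc : c ≠ 0)
    (hd : d ≠ 0) (he : e ≠ 0) (hdeb : ∀ k : ℤ, d * e ≠ b * q ^ k)
    (hdec : ∀ k : ℤ, d * e ≠ c * q ^ k) (hdebc : ∀ k : ℤ, d * e ≠ b * c * q ^ k)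
    (hzero : eightPsiTerm q d e (1 / b) (1 / c) (b * c / (d * e * f * q))
      (b * c / (d * e * g * q)) 0 ≠ 0)
    (hterm : ∀ n : ℤ, vwpPsiTerm (d * e)
      [b, c, d, e, d * e * f * q / (b * c), d * e * g * q / (b * c)] q (b * c / (f * g)) n =
        eightPsiTerm q d e (1 / b) (1 / c) (b * c / (d * e * f * q)) (b * c / (d * e * g * q)) n /
          eightPsiTerm q d e (1 / b) (1 / c) (b * c / (d * e * f * q))
            (b * c / (d * e * g * q)) 0) :
    kappa₂ q b d e *
        (thetaProd q [d * e * q / c, d * e / b] / thetaProd q [d * e * q / (b * c), d * e]) *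
        (Omega q [q] [b, c] * Omega q [b * c] [f, g, d * e, f * g, d * e * f, d * e * g] /
          Omega q [1 / (d * e)] [1 / b, 1 / c, f * g * q / (b * c) ^ 2]) *
        vwpPsi (d * e) [b, c, d, e, d * e * f * q / (b * c), d * e * g * q / (b * c)] q
          (b * c / (f * g)) =
      scaledShift q b c d e f g 0 := by
  rw [vwpPsi, tsum_congr hterm, tsum_div_const, first_term_coefficient_eq hq0 hq hb hc hd he hdeb
    hdec hdebc, mul_assoc, mul_div_cancel₀ _ hzero, mul_assoc, scaledShift,
    eightPsiShift_zero, eightPsi]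

end Assembly

end QSeries

theorem mainTheorem12 (q b c d e f g : ℂ)
    (hq0 : 0 < ‖q‖) (hq1 : ‖q‖ < 1)
    (hb : b ≠ 0) (hc : c ≠ 0) (hd : d ≠ 0) (he : e ≠ 0) (hf : f ≠ 0) (hg : g ≠ 0)
    (hconv₁ : ‖b * c / (f * g)‖ < 1)
    (hconv₂ : ‖(b * c) ^ 2 / (d * e * f * g * q)‖ < 1)
    -- no denominator of the unilateral series vanishes
    (hbd : ∀ k : ℕ, b * q ^ (k + 1) ≠ d) (hbe : ∀ k : ℕ, b * q ^ (k + 1) ≠ e)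
    (hbf : ∀ k : ℕ, b * q ^ (k + 1) ≠ f) (hbg : ∀ k : ℕ, b * q ^ (k + 1) ≠ g)
    -- no denominator of the right-hand side (bilateral series and coefficients) vanishes
    (hdq : ∀ k : ℤ, d ≠ q ^ k) (heq : ∀ k : ℤ, e ≠ q ^ k) (hdeq : ∀ k : ℤ, d * e ≠ q ^ k)
    (hdeb : ∀ k : ℤ, d * e ≠ b * q ^ k) (hdec : ∀ k : ℤ, d * e ≠ c * q ^ k)
    (hdebc : ∀ k : ℤ, d * e ≠ b * c * q ^ k)
    (hbq : ∀ k : ℕ, b ≠ q ^ (k + 1)) (hcq : ∀ k : ℕ, c ≠ q ^ (k + 1))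
    (hfbc : ∀ k : ℕ, b * c * q ^ k ≠ f) (hgbc : ∀ k : ℕ, b * c * q ^ k ≠ g)
    (hdef : ∀ k : ℕ, d * e * f ≠ b * c * q ^ k) (hdeg : ∀ k : ℕ, d * e * g ≠ b * c * q ^ k) :
    Summable (QSeries.uniTerm q b c d e f g) ∧
    Summable (QSeries.vwpPsiTerm (d * e)
      [b, c, d, e, d * e * f * q / (b * c), d * e * g * q / (b * c)] q (b * c / (f * g))) ∧
    QSeries.Omega q [b * q, c] [f, g] * ∑' n : ℕ, QSeries.uniTerm q b c d e f g n =
      QSeries.kappa₂ q b d e *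
          (QSeries.thetaProd q [d * e * q / c, d * e / b] /
            QSeries.thetaProd q [d * e * q / (b * c), d * e]) *
          (QSeries.Omega q [q] [b, c] *
              QSeries.Omega q [b * c] [f, g, d * e, f * g, d * e * f, d * e * g] /
            QSeries.Omega q [1 / (d * e)] [1 / b, 1 / c, f * g * q / (b * c) ^ 2]) *
          QSeries.vwpPsi (d * e)
            [b, c, d, e, d * e * f * q / (b * c), d * e * g * q / (b * c)] q (b * c / (f * g)) +
        QSeries.thetaProd q [1 / b, d * e * q / b] / QSeries.thetaProd q [1 / d, 1 / e] *
          (QSeries.Omega q [q / c] [1 / c, 1 / d, 1 / e] *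
              QSeries.Omega q [b * c] [d * f, d * g, e * f, e * g, f * g] /
            QSeries.Omega q [1 / (d * e)]
              [1 / (b * d * q), 1 / (b * e * q), b * c / ((d * e) ^ 2 * q),
                f * g * q / (b * c) ^ 2]) := by
  have hq0 := norm_pos_iff.1 hq0
  obtain ⟨hzero, hterm⟩ := QSeries.vwpPsiTerm_eq_eightPsiTerm hq0 hq1 hb hc hd he hf hg hdq heq hdeq
    hdeb hdec hbq hcq hfbc hgbc hdef hdeg
  have huni := QSeries.summable_uniTerm hq1 hd he hf hg hconv₂ hbd hbe hbf hbg
  have hpsi := QSeries.summable_eightPsiTerm (y₁ := 1 / b) (y₂ := 1 / c)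
    (y₃ := b * c / (d * e * f * q)) (y₄ := b * c / (d * e * g * q)) hq0 hq1 hd he hdq heq
    (by rwa [QSeries.sq_mul_sq_mul_prod_eq hq0 (mul_ne_zero hd he) hb hc])
  have hpartial (n : ℕ) : QSeries.Omega q [b * q, c] [f, g] *
      ∑ k ∈ Finset.range n, QSeries.uniTerm q b c d e f g k =
        QSeries.scaledShift q b c d e f g 0 - QSeries.scaledShift q b c d e f g n := by
    rw [Finset.mul_sum, ← Finset.sum_range_sub']
    exact Finset.sum_congr rfl fun k _ => (QSeries.scaledShift_sub_succ hq0 hq1 hb hc hd he hf hg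
      hdq heq hdeq hdebc hbd hbe hbf hbg hconv₁ hconv₂ k).symm
  have hlim := (QSeries.tendsto_scaledShift hq0 hq1 hb hc hd he hf hg hdq heq hdeq hbd hbe hconv₁
    hconv₂).const_sub (QSeries.scaledShift q b c d e f g 0)
  refine ⟨huni, (hpsi.div_const _).congr fun n => (hterm n).symm, ?_⟩
  rw [QSeries.kappa₂_mul_vwpPsi hq0 hq1 hb hc hd he hdeb hdec hdebc hzero hterm,
    ← sub_neg_eq_add]
  exact tendsto_nhds_unique ((huni.hasSum.tendsto_sum_nat.const_mul _).congr hpartial) hlim
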